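/- Consider a $K$-armed Bernoulli bandit with a single player. Let $\boldsymbol\mu=(\mu_1,\dots,\mu_K)\in[0,1]^K$ and $\mu_{(1)}=\max_k\mu_k$. The reward vectors $(X_k(t))_{k=1,\dots,K}$, $t\ge1$, are independent over time, and $X_k(t)$ is Bernoulli with mean $\mu_k$. Let $(Z_k(t))_{k,t}$ be i.i.d. standard Gaussian random variables, independent of the rewards. In round $t=1,2,\dots$ the player selects an arm $\pi(t)\in\{1,\dots,K\}$ as a function of past observations and of its internal randomization $Z$ up to time $t$, and receives the reward $r(t)=X_{\pi(t)}(t)$. Put $$N_k(t)=\sum_{s=1}^{t-1}\mathbf 1\{\pi(s)=k\},\qquad \hat\mu_k(t)=\frac{1}{\max(N_k(t),1)}\sum_{s=1}^{t-1}r(s)\,\mathbf 1\{\pi(s)=k\},$$ $$b_k(t)=\max\{q\in[0,1]:N_k(t)\,d(\hat\mu_k(t),q)\le f(t)\},\qquad f(t)=\log t+c\log\log t,$$ where $c\ge0$ is a constant and $d(p,q)=p\log\frac pq+(1-p)\log\frac{1-p}{1-q}\in[0,\infty]$ is the Kullback-Leibler divergence between Bernoulli distributions with means $p$ and $q$ (with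 the usual conventions $0\log 0=0\log\frac00=0$ and $x\log\frac x0=+\infty$ for $x>0$, and $0\cdot\infty=0$). Randomized Selfish KL-UCB selects $$\pi(t)\in\arg\max_{k=1,\dots,K}\Big\{b_k(t)+\frac{Z_k(t)}{t}\Big\},$$ with ties broken arbitrarily; in the rounds $t\in\{1,2\}$, where $f(t)$ may be undefined or negative, the choice of the arm is arbitrary. Then for every $\boldsymbol\mu\in[0,1]^K$, every $c\ge 0$ and every arm $k$ with $\mu_k<\mu_{(1)}$, $$\limsup_{T\to\infty}\frac{\mathbb E[N_k(T)]}{\log T}\le\frac1{d(\mu_k,\mu_{(1)})}$$ (with $1/\infty=0$). Hence the algorithm is asymptotically optimal, in the sense that its regret $R_{\boldsymbol\mu}(T)=\sum_{t=1}^T\big(\mu_{(1)}-\mathbb E[r(t)]\big)$ satisfies $$\limsup_{T\to\infty}\frac{R_{\boldsymbol\mu}(T)}{\log T}\le\sum_{k:\,\mu_k<\mu_{(1)}}\frac{\mu_{(1)}-\mu_k}{d(\mu_k,\mu_{(1)})}.$$ -/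

import Mathlib

open MeasureTheory ProbabilityTheory Filter

namespace RandSelfishKLUCB

/-- Kullback-Leibler divergence between the Bernoulli distributions with means `p` and `q`
(`p, q ∈ [0, 1]`), with the usual conventions `0 log 0 = 0 log (0 / 0) = 0` and
`x log (x / 0) = +∞` for `x > 0`. -/
noncomputable def bernoulliKL (p q : ℝ) : EReal :=
  if (q = 0 ∧ p ≠ 0) ∨ (q = 1 ∧ p ≠ 1) then ⊤
  else ((p * Real.log (p / q) + (1 - p) * Real.log ((1 - p) / (1 - q)) : ℝ) : EReal)

/-- The exploration function `f(t) = log t + c log log t`. -/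
noncomputable def explore (c : ℝ) (t : ℕ) : ℝ :=
  Real.log t + c * Real.log (Real.log t)

/-- The KL-UCB index `max {q ∈ [0, 1] : n d(p, q) ≤ f}` of an arm that was pulled `n` times with
empirical mean `p`. For `p ∈ [0, 1]` and `f ≥ 0` the set is nonempty and closed, so that the
supremum is a maximum; for `n = 0` the index is `1`. -/
noncomputable def klIndex (n : ℕ) (p f : ℝ) : ℝ :=
  sSup {q : ℝ | q ∈ Set.Icc (0 : ℝ) 1 ∧ ((n : ℝ) : EReal) * bernoulliKL p q ≤ (f : EReal)}

/-- The largest mean reward `μ_(1)`. -/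
noncomputable def bestMean {K : ℕ} (μ : Fin K → unitInterval) : ℝ :=
  ⨆ j, (μ j : ℝ)

section Statistics

variable {Ω : Type*} {K : ℕ}

/-- The reward `r(t) = X_{π(t)}(t)` received in round `t` (a single player never collides). -/
def reward (X : Fin K → ℕ → Ω → ℝ) (π : ℕ → Ω → Fin K) (t : ℕ) (ω : Ω) : ℝ :=
  X (π t ω) t ω

/-- `N_k(t)`: the number of rounds `s ∈ {1, …, t - 1}` in which arm `k` was selected. -/
def pulls (π : ℕ → Ω → Fin K) (k : Fin K) (t : ℕ) (ω : Ω) : ℕ :=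
  ((Finset.Ico 1 t).filter (fun s => π s ω = k)).card

/-- The average reward obtained from arm `k` in the rounds `1, …, t - 1`. -/
noncomputable def empMean (X : Fin K → ℕ → Ω → ℝ) (π : ℕ → Ω → Fin K)
    (k : Fin K) (t : ℕ) (ω : Ω) : ℝ :=
  (∑ s ∈ Finset.Ico 1 t, if π s ω = k then reward X π s ω else 0) /
    (max (pulls π k t ω) 1 : ℕ)

/-- The perturbed index `b_k(t) + Z_k(t) / t`. -/
noncomputable def perturbedIndex (c : ℝ) (X Z : Fin K → ℕ → Ω → ℝ) (π : ℕ → Ω → Fin K)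
    (k : Fin K) (t : ℕ) (ω : Ω) : ℝ :=
  klIndex (pulls π k t ω) (empMean X π k t ω) (explore c t) + Z k t ω / t

/-- The information available when the arm of round `t` is selected: the arms' rewards of the
earlier rounds and the internal randomization up to round `t`. (The player sees only part of it;
a decision based on the observations alone is in particular measurable for this σ-algebra.) -/
abbrev history (X Z : Fin K → ℕ → Ω → ℝ) (t : ℕ) : MeasurableSpace Ω :=
  (⨆ s ∈ Finset.range t, ⨆ j, MeasurableSpace.comap (X j s) inferInstance) ⊔
    (⨆ s ∈ Finset.range (t + 1), ⨆ j, MeasurableSpace.comap (Z j s) inferInstance)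

/-- The regret `∑_{t = 1}^T (μ_(1) - E[r(t)])`. -/
noncomputable def regret [MeasurableSpace Ω] (P : Measure Ω) (μ : Fin K → unitInterval)
    (X : Fin K → ℕ → Ω → ℝ) (π : ℕ → Ω → Fin K) (T : ℕ) : ℝ :=
  ∑ t ∈ Finset.Icc 1 T, (bestMean μ - ∫ ω, reward X π t ω ∂P)

/-- The random environment: rounds are `t = 1, 2, …` (index `0` is a dummy with no prescribed law).
The reward vectors `(X_k(t))_k` are independent over time, `X_k(t)` is Bernoulli with mean `μ_k`
(any dependence between the arms within one round is allowed), the `Z_k(t)` are i.i.d. standard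
Gaussian, and the rewards are independent of the `Z_k(t)`. -/
structure IsEnvironment [MeasurableSpace Ω] (P : Measure Ω) (μ : Fin K → unitInterval)
    (X Z : Fin K → ℕ → Ω → ℝ) : Prop where
  measurable_X : ∀ k t, Measurable (X k t)
  measurable_Z : ∀ k t, Measurable (Z k t)
  law_X : ∀ k t, 1 ≤ t → HasLaw (X k t) (bernoulliMeasure (1 : ℝ) 0 (μ k)) P
  law_Z : ∀ k t, 1 ≤ t → HasLaw (Z k t) (gaussianReal 0 1) P
  indep_X : iIndepFun (fun (t : ℕ) (ω : Ω) (k : Fin K) => X k t ω) P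
  indep_Z : iIndepFun (fun (i : Fin K × ℕ) (ω : Ω) => Z i.1 i.2 ω) P
  indep_XZ : IndepFun (fun (ω : Ω) (i : Fin K × ℕ) => X i.1 i.2 ω)
    (fun (ω : Ω) (i : Fin K × ℕ) => Z i.1 i.2 ω) P

/-- `π` is a run of Randomized Selfish KL-UCB by a single player: the arm of each round is selected
from past information, and it maximizes the perturbed index; ties are broken in any way.
In rounds `1` and `2`, where `f(t)` is undefined or possibly negative because of the `log log t`
term, the choice is arbitrary. -/
structure IsRun [MeasurableSpace Ω] (P : Measure Ω) (c : ℝ)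
    (X Z : Fin K → ℕ → Ω → ℝ) (π : ℕ → Ω → Fin K) : Prop where
  adapted : ∀ t, 1 ≤ t → Measurable[history X Z t] (π t)
  argmax : ∀ t, 3 ≤ t → ∀ᵐ ω ∂P, ∀ j,
    perturbedIndex c X Z π j t ω ≤ perturbedIndex c X Z π (π t ω) t ω

end Statistics

end RandSelfishKLUCB

/-! Fix a suboptimal arm `k`, an optimal arm `i`, and levels `μ k < p < q < μ i`. A round `t ≥ 3`
that selects `k` falls under one of three cases: a perturbation of `k` or `i` reaches `δ`; the index
of `i` is below `q + 2δ`; or the index of `k` exceeds `q`. Rounds of the last kind carry distinct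
pull counts `n`, and each has either `n ≤ f(T) / kl(p, q)` or an empirical mean of at least `p`
(`pulls_le_sum_indicator`). Everything except `f(T) / kl(p, q)` has bounded expectation, and `p ↓ μ
k`, `q ↑ μ i` gives the constant.

The probabilities come from a betting argument. A gambler bets on an arm during its first `n` pulls,
with factors of mean at most 1; the final capital has mean at most 1 (`lintegral_capital_le`) and is
`a ^ j * b ^ (n - j)` whenever the arm passes through `n` pulls and `j` successes. Markov's
inequality thus bounds the probability of such a passage at any time up to `T`, with no union over
times (`measureReal_visits_mul_le`).

For the optimal arm, the strict gap between `q + 2δ` and `μ i` adds an exponential gain in `n` to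
the usual `exp(-n kl)`. A low index forces `n` to be at least of order `log t`, so the bound
improves from `1 / t` to the summable `1 / t ^ (1 + g)`, whatever `c ≥ 0` is. The noise `Z / t` is
handled by Chebyshev's inequality, which gives `1 / t ^ 2`. -/

namespace RandSelfishKLUCB

/-! ### Inequalities for the Bernoulli divergence -/

/-- The Bernoulli Kullback-Leibler divergence as a real number (meaningful for `0 < q < 1`). -/
noncomputable def klReal (p q : ℝ) : ℝ :=
  p * Real.log (p / q) + (1 - p) * Real.log ((1 - p) / (1 - q))

lemma bernoulliKL_eq_klReal {p q : ℝ} (h0 : 0 < q) (h1 : q < 1) :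
    bernoulliKL p q = (klReal p q : EReal) := by
  rw [bernoulliKL, if_neg]
  · rfl
  · rintro (⟨h, -⟩ | ⟨h, -⟩) <;> linarith

lemma bernoulliKL_self {p : ℝ} : bernoulliKL p p = 0 := by
  rw [bernoulliKL, if_neg (by tauto)]
  have h1 : p * Real.log (p / p) = 0 := by
    rcases eq_or_ne p 0 with h | h
    · simp [h]
    · simp [div_self h]
  have h2 : (1 - p) * Real.log ((1 - p) / (1 - p)) = 0 := by
    rcases eq_or_ne (1 - p) 0 with h | h
    · simp [h]
    · simp [div_self h]
  rw [h1, h2]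
  simp

lemma mul_log_div_eq {x y : ℝ} (hy : y ≠ 0) :
    x * Real.log (x / y) = x * Real.log x - x * Real.log y := by
  rcases eq_or_ne x 0 with rfl | hx
  · simp
  · rw [Real.log_div hx hy]; ring

lemma klReal_eq {p q : ℝ} (h0 : 0 < q) (h1 : q < 1) :
    klReal p q = p * Real.log p + (1 - p) * Real.log (1 - p)
      - p * Real.log q - (1 - p) * Real.log (1 - q) := by
  rw [klReal, mul_log_div_eq h0.ne', mul_log_div_eq (by linarith : (1 - q) ≠ 0)]
  ring

lemma sub_le_mul_log_div {x y : ℝ} (hx : 0 ≤ x) (hy : 0 < y) :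
    x - y ≤ x * Real.log (x / y) := by
  rcases hx.eq_or_lt with rfl | hx
  · simp [hy.le]
  · have := Real.one_sub_inv_le_log_of_pos (div_pos hx hy)
    calc x - y = x * (1 - (x / y)⁻¹) := by field_simp
      _ ≤ _ := mul_le_mul_of_nonneg_left this hx.le

lemma klReal_nonneg {p q : ℝ} (hp0 : 0 ≤ p) (hp1 : p ≤ 1) (h0 : 0 < q) (h1 : q < 1) :
    0 ≤ klReal p q := by
  have e1 := sub_le_mul_log_div hp0 h0
  have e2 := sub_le_mul_log_div (by linarith : 0 ≤ 1 - p) (by linarith : 0 < 1 - q)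
  rw [klReal]
  linarith

/-- Tangent-line inequality at `q` for the convex function `klReal p ·`, whose slope there is `(q -
p) / (q (1 - q))`. -/
lemma klReal_add_le_klReal {p q r : ℝ} (hp0 : 0 ≤ p) (hp1 : p ≤ 1) (h0 : 0 < q) (hqr : q ≤ r)
    (h1 : r < 1) :
    klReal p q + (r - q) * (q - p) / (q * (1 - q)) ≤ klReal p r := by
  rw [klReal_eq h0 (by linarith), klReal_eq (by linarith) h1]
  have e1 := Real.one_sub_inv_le_log_of_pos (div_pos h0 (by linarith : 0 < r))
  have e2 := Real.one_sub_inv_le_log_of_pos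
    (div_pos (by linarith : 0 < 1 - q) (by linarith : 0 < 1 - r))
  rw [Real.log_div (by linarith) (by linarith)] at e1 e2
  have f1 := mul_le_mul_of_nonneg_left e1 hp0
  have f2 := mul_le_mul_of_nonneg_left e2 (by linarith : 0 ≤ 1 - p)
  have h2 : (1 : ℝ) - q ≠ 0 := by linarith
  have h3 : (1 : ℝ) - r ≠ 0 := by linarith
  have h4 : r ≠ 0 := by linarith
  have e3 : (r - q) * (q - p) / (q * (1 - q))
      = p * (1 - (q / r)⁻¹) + (1 - p) * (1 - ((1 - q) / (1 - r))⁻¹) := by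
    field_simp
    ring
  rw [e3]
  linarith

lemma klReal_mono_right {p q r : ℝ} (hp0 : 0 ≤ p) (hpq : p ≤ q) (h0 : 0 < q) (hqr : q ≤ r)
    (h1 : r < 1) : klReal p q ≤ klReal p r := by
  have := klReal_add_le_klReal hp0 (by linarith) h0 hqr h1
  have h : 0 ≤ (r - q) * (q - p) / (q * (1 - q)) :=
    div_nonneg (mul_nonneg (by linarith) (by linarith)) (mul_nonneg (by linarith) (by linarith))
  linarith

lemma klReal_pos {p q : ℝ} (hp0 : 0 ≤ p) (hpq : p < q) (h1 : q < 1) : 0 < klReal p q := by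
  -- The tangent is taken at the midpoint: at `p` itself the slope would vanish, and `p` may be `0`.
  have := klReal_add_le_klReal (q := (p + q) / 2) hp0 (by linarith) (by linarith)
    (by linarith : _ ≤ q) h1
  have h : 0 < (q - (p + q) / 2) * ((p + q) / 2 - p) / ((p + q) / 2 * (1 - (p + q) / 2)) :=
    div_pos (mul_pos (by linarith) (by linarith)) (mul_pos (by linarith) (by linarith))
  have := klReal_nonneg (q := (p + q) / 2) hp0 (by linarith) (by linarith) (by linarith)
  linarith

/-- Three-point identity: `kl(p,q) - kl(r,q)` equals `kl(p,r)` plus `(r - p)` times the difference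
of log-odds of `q` and `r`, both nonnegative. -/
lemma klReal_anti_left {p r q : ℝ} (hp0 : 0 ≤ p) (hpr : p ≤ r) (hr : 0 < r) (hrq : r ≤ q)
    (h1 : q < 1) : klReal r q ≤ klReal p q := by
  have h := klReal_nonneg (q := r) hp0 (by linarith) hr (by linarith)
  rw [klReal_eq hr (by linarith)] at h
  rw [klReal_eq (by linarith) h1, klReal_eq (by linarith) h1]
  have e1 : Real.log r ≤ Real.log q := Real.log_le_log hr hrq
  have e2 : Real.log (1 - q) ≤ Real.log (1 - r) := Real.log_le_log (by linarith) (by linarith)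
  nlinarith [mul_nonneg (sub_nonneg.2 hpr)
    (by linarith : 0 ≤ Real.log q - Real.log r + (Real.log (1 - r) - Real.log (1 - q)))]

lemma klReal_le_neg_log {p q : ℝ} (hp0 : 0 ≤ p) (hpq : p ≤ q) (h0 : 0 < q) (h1 : q < 1) :
    klReal p q ≤ -Real.log (1 - q) := by
  rw [klReal]
  have e1 : p * Real.log (p / q) ≤ 0 :=
    mul_nonpos_of_nonneg_of_nonpos hp0
      (Real.log_nonpos (div_nonneg hp0 h0.le) ((div_le_one h0).2 hpq))
  have e2 : Real.log ((1 - p) / (1 - q)) ≤ -Real.log (1 - q) := by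
    rw [Real.log_div (by linarith) (by linarith)]
    have := Real.log_nonpos (by linarith : 0 ≤ 1 - p) (by linarith)
    linarith
  have e3 : 0 ≤ Real.log ((1 - p) / (1 - q)) :=
    Real.log_nonneg ((one_le_div (by linarith)).2 (by linarith))
  nlinarith

/-- The likelihood ratio of `n` trials with `j` successes, between their own empirical mean and `q`,
depends on the data only through the divergence. The cases `j = 0` and `j = n` survive because `0 ^
0 = 1`. -/
lemma pow_mul_pow_eq_exp_klReal {n j : ℕ} (hj : j ≤ n) (hn : 0 < n) {q : ℝ} (h0 : 0 < q)
    (h1 : q < 1) :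
    ((j / n : ℝ) / q) ^ j * ((1 - (j / n : ℝ)) / (1 - q)) ^ (n - j)
      = Real.exp (n * klReal (j / n) q) := by
  have hn' : (0 : ℝ) < n := by exact_mod_cast hn
  have key : ∀ (m : ℕ) (x : ℝ), 0 ≤ x → (x = 0 → m = 0) →
      x ^ m = Real.exp (m * Real.log x) := by
    intro m x hx h
    rcases hx.eq_or_lt with rfl | hx
    · simp [h rfl]
    · rw [mul_comm, Real.exp_mul, Real.exp_log hx, Real.rpow_natCast]
  have hle : (j / n : ℝ) ≤ 1 := (div_le_one hn').2 (by exact_mod_cast hj)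
  rw [key j _ (by positivity), key (n - j) _ (div_nonneg (by linarith) (by linarith)),
    ← Real.exp_add, klReal]
  · congr 1
    push_cast [Nat.cast_sub hj]
    have : (n : ℝ) - j = n * (1 - j / n) := by field_simp
    rw [this]
    have : (j : ℝ) = n * (j / n) := by field_simp
    nth_rw 1 [this]
    ring
  · intro h
    rcases div_eq_zero_iff.1 h with h | h
    · have : (j : ℝ) = n := by field_simp at h; linarith
      have : j = n := by exact_mod_cast this
      omega
    · linarith
  · intro h
    have : (j : ℝ) = 0 := by
      rcases div_eq_zero_iff.1 h with h | h
      · rcases div_eq_zero_iff.1 h with h | h <;> linarith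
      · linarith
    exact_mod_cast this

/-! ### The KL-UCB index and the exploration function -/

lemma bddAbove_klIndex_set (n : ℕ) (p f : ℝ) :
    BddAbove {q : ℝ | q ∈ Set.Icc (0 : ℝ) 1 ∧ ((n : ℝ) : EReal) * bernoulliKL p q ≤ (f : EReal)} :=
  ⟨1, fun _ h => h.1.2⟩

lemma self_mem_klIndex_set (n : ℕ) {p f : ℝ} (hp0 : 0 ≤ p) (hp1 : p ≤ 1) (hf : 0 ≤ f) :
    p ∈ {q : ℝ | q ∈ Set.Icc (0 : ℝ) 1 ∧
      ((n : ℝ) : EReal) * bernoulliKL p q ≤ (f : EReal)} := by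
  refine ⟨⟨hp0, hp1⟩, ?_⟩
  rw [bernoulliKL_self, mul_zero]
  exact_mod_cast hf

lemma of_klIndex_lt {n : ℕ} {p f q : ℝ} (hp0 : 0 ≤ p) (hp1 : p ≤ 1) (hf : 0 ≤ f) (h0 : 0 < q)
    (h1 : q < 1) (h : klIndex n p f < q) : p < q ∧ f < n * klReal p q := by
  refine ⟨(le_csSup (bddAbove_klIndex_set n p f)
    (self_mem_klIndex_set n hp0 hp1 hf)).trans_lt h, ?_⟩
  by_contra! hle
  refine absurd (le_csSup (bddAbove_klIndex_set n p f) ⟨⟨h0.le, h1.le⟩, ?_⟩) (not_le.2 h)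
  rw [bernoulliKL_eq_klReal h0 h1]
  exact_mod_cast hle

lemma mul_klReal_le_of_lt_klIndex {n : ℕ} {p f q : ℝ} (hp0 : 0 ≤ p) (hpq : p < q) (hf : 0 ≤ f)
    (h1 : q < 1) (h : q < klIndex n p f) : n * klReal p q ≤ f := by
  rcases Nat.eq_zero_or_pos n with rfl | hn
  · simpa using hf
  obtain ⟨x, ⟨⟨-, hx1⟩, hx⟩, hqx⟩ := exists_lt_of_lt_csSup
    ⟨p, self_mem_klIndex_set n hp0 (by linarith) hf⟩ h
  have hn' : (0 : ℝ) < n := by exact_mod_cast hn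
  -- The point `1` cannot satisfy the constraint: its divergence from `p < 1` is infinite and `n >
  -- 0`.
  rcases hx1.eq_or_lt with rfl | hx1
  · rw [bernoulliKL, if_pos (Or.inr ⟨rfl, by linarith⟩),
      EReal.coe_mul_top_of_pos hn'] at hx
    simp at hx
  · rw [bernoulliKL_eq_klReal (by linarith) hx1] at hx
    have hx' : n * klReal p x ≤ f := by exact_mod_cast hx
    exact (mul_le_mul_of_nonneg_left (klReal_mono_right hp0 hpq.le (by linarith) hqx.le hx1)
      hn'.le).trans hx'

lemma explore_mono {c : ℝ} (hc : 0 ≤ c) {s t : ℕ} (hs : 3 ≤ s) (hst : s ≤ t) :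
    explore c s ≤ explore c t := by
  have hs' : (3 : ℝ) ≤ s := by exact_mod_cast hs
  have h1 : Real.log s ≤ Real.log t := Real.log_le_log (by linarith) (by exact_mod_cast hst)
  have h0 : 0 < Real.log s := Real.log_pos (by linarith)
  have := mul_le_mul_of_nonneg_left (Real.log_le_log h0 h1) hc
  rw [explore, explore]
  linarith

/-- From round 3 on, `log t ≥ 1` because `e < 3`, so the `log log` term is nonnegative. -/
lemma log_le_explore {c : ℝ} (hc : 0 ≤ c) {t : ℕ} (ht : 3 ≤ t) :
    Real.log t ≤ explore c t := by
  have ht' : (3 : ℝ) ≤ t := by exact_mod_cast ht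
  have h1 : 1 ≤ Real.log t := by
    rw [Real.le_log_iff_exp_le (by linarith)]
    linarith [Real.exp_one_lt_d9]
  have := mul_nonneg hc (Real.log_nonneg h1)
  rw [explore]
  linarith

lemma explore_nonneg {c : ℝ} (hc : 0 ≤ c) {t : ℕ} (ht : 3 ≤ t) : 0 ≤ explore c t :=
  (Real.log_nonneg (by exact_mod_cast (by omega : 1 ≤ t))).trans (log_le_explore hc ht)

end RandSelfishKLUCB

/-! ### Independence of the past and the betting supermartingale -/

namespace RandSelfishKLUCB

/-- Used with past rewards `mA`, current reward `mB` and randomization `mC`. On the π-system of sets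
`u ∩ v` generating `mA ⊔ mC`, the hypotheses factor the probability of `u ∩ v ∩ s` completely. -/
lemma indep_sup_left_of_indep_sup {Ω : Type*} {mA mB mC m : MeasurableSpace Ω} {P : @Measure Ω m}
    [IsProbabilityMeasure P] (hA : mA ≤ m) (hB : mB ≤ m) (hC : mC ≤ m)
    (hAB : Indep mA mB P) (hABC : Indep (mA ⊔ mB) mC P) : Indep (mA ⊔ mC) mB P := by
  have hpi : IsPiSystem {s | ∃ u v, MeasurableSet[mA] u ∧ MeasurableSet[mC] v ∧ u ∩ v = s} := by
    rintro _ ⟨u, v, hu, hv, rfl⟩ _ ⟨u', v', hu', hv', rfl⟩ -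
    exact ⟨u ∩ u', v ∩ v', hu.inter hu', hv.inter hv', Set.inter_inter_inter_comm _ _ _ _⟩
  refine IndepSets.indep (sup_le hA hC) hB hpi
    (p2 := {s | MeasurableSet[mB] s}) (@MeasurableSpace.isPiSystem_measurableSet Ω mB)
    (le_antisymm (sup_le ?_ ?_) ?_) (@MeasurableSpace.generateFrom_measurableSet Ω mB).symm ?_
  · exact fun s hs => MeasurableSpace.measurableSet_generateFrom
      ⟨s, Set.univ, hs, MeasurableSet.univ, Set.inter_univ s⟩
  · exact fun s hs => MeasurableSpace.measurableSet_generateFrom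
      ⟨Set.univ, s, MeasurableSet.univ, hs, Set.univ_inter s⟩
  · refine MeasurableSpace.generateFrom_le ?_
    rintro _ ⟨u, v, hu, hv, rfl⟩
    exact ((le_sup_left : mA ≤ mA ⊔ mC) u hu).inter ((le_sup_right : mC ≤ mA ⊔ mC) v hv)
  · rw [IndepSets_iff]
    rintro _ s ⟨u, v, hu, hv, rfl⟩ hs
    rw [Indep_iff] at hAB hABC
    rw [Set.inter_right_comm, hABC (u ∩ s) v (((le_sup_left : mA ≤ mA ⊔ mB) u hu).inter
      ((le_sup_right : mB ≤ mA ⊔ mB) s hs)) hv, hAB u s hu hs,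
      hABC u v ((le_sup_left : mA ≤ mA ⊔ mB) u hu) hv]
    ring

variable {Ω : Type*} {K : ℕ}

section

variable {mΩ : MeasurableSpace Ω} {P : Measure Ω}
  {μ : Fin K → unitInterval} {c : ℝ} {X Z : Fin K → ℕ → Ω → ℝ} {π : ℕ → Ω → Fin K}

lemma IsEnvironment.history_le (h : IsEnvironment P μ X Z) (t : ℕ) :
    history X Z t ≤ mΩ :=
  sup_le (iSup₂_le fun s _ => iSup_le fun j => (h.measurable_X j s).comap_le)
    (iSup₂_le fun s _ => iSup_le fun j => (h.measurable_Z j s).comap_le)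

lemma IsEnvironment.indep_history [IsProbabilityMeasure P] (h : IsEnvironment P μ X Z) (k : Fin K) (t : ℕ) :
    Indep (history X Z t) (MeasurableSpace.comap (X k t) inferInstance) P := by
  have hm : ∀ s, Measurable (fun ω (k : Fin K) => X k s ω) :=
    fun s => measurable_pi_lambda _ fun k => h.measurable_X k s
  have hcoord : ∀ j s, MeasurableSpace.comap (X j s) inferInstance ≤
      MeasurableSpace.comap (fun ω (k : Fin K) => X k s ω) inferInstance := by
    intro j s
    have : X j s = (fun x : Fin K → ℝ => x j) ∘ (fun ω (k : Fin K) => X k s ω) := rfl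
    rw [this, ← MeasurableSpace.comap_comp]
    exact MeasurableSpace.comap_mono (measurable_pi_apply j).comap_le
  have hallX : ∀ j s, MeasurableSpace.comap (X j s) inferInstance ≤
      MeasurableSpace.comap (fun ω (i : Fin K × ℕ) => X i.1 i.2 ω) inferInstance := by
    intro j s
    have : X j s = (fun x : Fin K × ℕ → ℝ => x (j, s)) ∘
      (fun ω (i : Fin K × ℕ) => X i.1 i.2 ω) := rfl
    rw [this, ← MeasurableSpace.comap_comp]
    exact MeasurableSpace.comap_mono (measurable_pi_apply (j, s)).comap_le
  have hallZ : ∀ j s, MeasurableSpace.comap (Z j s) inferInstance ≤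
      MeasurableSpace.comap (fun ω (i : Fin K × ℕ) => Z i.1 i.2 ω) inferInstance := by
    intro j s
    have : Z j s = (fun x : Fin K × ℕ → ℝ => x (j, s)) ∘
      (fun ω (i : Fin K × ℕ) => Z i.1 i.2 ω) := rfl
    rw [this, ← MeasurableSpace.comap_comp]
    exact MeasurableSpace.comap_mono (measurable_pi_apply (j, s)).comap_le
  refine indep_sup_left_of_indep_sup
    (iSup₂_le fun s _ => iSup_le fun j => (h.measurable_X j s).comap_le)
    (h.measurable_X k t).comap_le
    (iSup₂_le fun s _ => iSup_le fun j => (h.measurable_Z j s).comap_le) ?_ ?_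
  · have hd := indep_iSup_of_disjoint (fun s => (hm s).comap_le) h.indep_X
      (S := (Finset.range t : Set ℕ)) (T := {t}) (by simp)
    refine indep_of_indep_of_le_left (indep_of_indep_of_le_right hd ?_) ?_
    · simpa using hcoord k t
    · refine iSup₂_le fun s hs => iSup_le fun j => (hcoord j s).trans ?_
      exact le_iSup₂ (f := fun s (_ : s ∈ (Finset.range t : Set ℕ)) =>
        MeasurableSpace.comap (fun ω (k : Fin K) => X k s ω) inferInstance) s hs
  · refine indep_of_indep_of_le_left (indep_of_indep_of_le_right
      ((IndepFun_iff_Indep _ _ _).1 h.indep_XZ) ?_) ?_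
    · exact iSup₂_le fun s _ => iSup_le fun j => hallZ j s
    · exact sup_le (iSup₂_le fun s _ => iSup_le fun j => hallX j s) (hallX k t)

lemma history_mono {s t : ℕ} (hst : s ≤ t) : history X Z s ≤ history X Z t := by
  refine sup_le_sup ?_ ?_
  · exact biSup_mono fun i hi => by simp at hi ⊢; omega
  · exact biSup_mono fun i hi => by simp at hi ⊢; omega

lemma measurable_X_history (k : Fin K) {s t : ℕ} (hst : s < t) :
    Measurable[history X Z t] (X k s) := by
  rw [measurable_iff_comap_le]
  refine le_trans ?_ le_sup_left
  refine le_trans (le_iSup (fun j => MeasurableSpace.comap (X j s) inferInstance) k) ?_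
  exact le_iSup₂ (f := fun s (_ : s ∈ Finset.range t) =>
    ⨆ j, MeasurableSpace.comap (X j s) inferInstance) s (Finset.mem_range.2 hst)

lemma IsEnvironment.ae_eq_one_or_zero (h : IsEnvironment P μ X Z) (k : Fin K) {t : ℕ}
    (ht : 1 ≤ t) : ∀ᵐ ω ∂P, X k t ω = 1 ∨ X k t ω = 0 := by
  have hms : MeasurableSet {x : ℝ | ¬ (x = 1 ∨ x = 0)} := by
    have : {x : ℝ | ¬ (x = 1 ∨ x = 0)} = ({1, 0} : Set ℝ)ᶜ := by ext; simp
    rw [this]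
    exact (Set.toFinite _).measurableSet.compl
  rw [ae_iff, (h.law_X k t ht).measure_eq (p := fun x => ¬ (x = 1 ∨ x = 0)) hms]
  classical
  rw [bernoulliMeasure_apply _ hms]
  simp

/-- The betting weight collected in round `s` on arm `k`: `a` for a success and `b` for a
failure. -/
noncomputable def betFactor (X : Fin K → ℕ → Ω → ℝ) (k : Fin K) (a b : ENNReal) (s : ℕ) (ω : Ω) :
    ENNReal :=
  if X k s ω = 1 then a else b

open Classical in
/-- The capital of a gambler who bets on arm `k` in the rounds `s` in which the event `I s`
occurs. -/
noncomputable def capital (X : Fin K → ℕ → Ω → ℝ) (k : Fin K) (I : ℕ → Set Ω) (a b : ENNReal)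
    (T : ℕ) (ω : Ω) : ENNReal :=
  ∏ s ∈ Finset.Ico 1 T, if ω ∈ I s then betFactor X k a b s ω else 1

lemma measurable_betFactor {m : MeasurableSpace Ω} {k : Fin K} {s : ℕ}
    (h : Measurable[m] (X k s)) (a b : ENNReal) : Measurable[m] (betFactor X k a b s) :=
  Measurable.ite (h (measurableSet_singleton 1)) measurable_const measurable_const

lemma IsEnvironment.lintegral_betFactor (h : IsEnvironment P μ X Z) (k : Fin K) {t : ℕ}
    (ht : 1 ≤ t) (a b : ENNReal) :
    ∫⁻ ω, betFactor X k a b t ω ∂P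
      = a * ENNReal.ofReal (μ k) + b * ENNReal.ofReal (1 - μ k) := by
  have hm : Measurable (fun x : ℝ => if x = 1 then a else b) :=
    Measurable.ite (measurableSet_singleton 1) measurable_const measurable_const
  have := (h.law_X k t ht).lintegral_comp hm.aemeasurable
  unfold betFactor
  rw [this, bernoulliMeasure_def, lintegral_add_measure, lintegral_smul_measure,
    lintegral_smul_measure, lintegral_dirac' _ hm, lintegral_dirac' _ hm]
  simp only [ENNReal.smul_def, smul_eq_mul, if_true, zero_ne_one, if_false]
  rw [mul_comm a, mul_comm b]
  have e1 : (unitInterval.toNNReal (μ k) : ENNReal) = ENNReal.ofReal (μ k) := by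
    rw [← ENNReal.ofReal_coe_nnreal]; rfl
  have e2 : (unitInterval.toNNReal (unitInterval.symm (μ k)) : ENNReal)
      = ENNReal.ofReal (1 - μ k) := by
    rw [← ENNReal.ofReal_coe_nnreal]; rfl
  rw [e1, e2]

/-- Supermartingale property: whether to bet in round `T` is decided by the history, which is
independent of `X k T`, and `hab` says that a bet does not gain on average. Measurability is part of
the induction because independence needs it. -/
lemma IsEnvironment.lintegral_capital_le [IsProbabilityMeasure P] (h : IsEnvironment P μ X Z) (k : Fin K)
    {I : ℕ → Set Ω} (hI : ∀ s, 1 ≤ s → MeasurableSet[history X Z s] (I s)) {a b : ENNReal}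
    (hab : a * ENNReal.ofReal (μ k) + b * ENNReal.ofReal (1 - μ k) ≤ 1) (T : ℕ) :
    Measurable[history X Z T] (capital X k I a b T) ∧
      ∫⁻ ω, capital X k I a b T ω ∂P ≤ 1 := by
  classical
  induction T with
  | zero =>
      constructor
      · have : capital X k I a b 0 = fun _ => 1 := by funext; simp [capital]
        rw [this]; exact measurable_const
      · simp [capital]
  | succ T ih =>
    rcases Nat.eq_zero_or_pos T with rfl | hT
    · constructor
      · have : capital X k I a b (0 + 1) = fun _ => 1 := by funext; simp [capital]
        rw [this]; exact measurable_const
      · simp [capital]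
    have hstep : capital X k I a b (T + 1) =
        fun ω => capital X k I a b T ω * (if ω ∈ I T then betFactor X k a b T ω else 1) := by
      funext ω
      rw [capital, capital, Finset.prod_Ico_succ_top hT]
    have hle := history_mono (X := X) (Z := Z) (Nat.le_succ T)
    constructor
    · rw [hstep]
      exact (ih.1.mono hle le_rfl).mul (Measurable.ite (hle _ (hI T hT))
        (measurable_betFactor (measurable_X_history k (Nat.lt_succ_self T)) a b)
        measurable_const)
    · have hIm : MeasurableSet (I T) := h.history_le T _ (hI T hT)
      have hcm : Measurable (capital X k I a b T) := ih.1.mono (h.history_le T) le_rfl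
      have hsplit : ∀ ω, capital X k I a b (T + 1) ω =
          (I T).indicator (capital X k I a b T) ω * betFactor X k a b T ω
            + (I T)ᶜ.indicator (capital X k I a b T) ω := by
        intro ω
        rw [hstep]
        by_cases hω : ω ∈ I T <;> simp [hω]
      simp_rw [hsplit]
      have hfm : Measurable[history X Z T] ((I T).indicator (capital X k I a b T)) :=
        ih.1.indicator (hI T hT)
      rw [lintegral_add_right _ (hcm.indicator hIm.compl),
        lintegral_mul_eq_lintegral_mul_lintegral_of_independent_measurableSpace
          (h.history_le T) (h.measurable_X k T).comap_le (h.indep_history k T) hfm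
          (measurable_betFactor (comap_measurable _) a b), h.lintegral_betFactor k hT]
      calc _ ≤ (∫⁻ ω, (I T).indicator (capital X k I a b T) ω ∂P) * 1
            + ∫⁻ ω, (I T)ᶜ.indicator (capital X k I a b T) ω ∂P := by gcongr
        _ = ∫⁻ ω, capital X k I a b T ω ∂P := by
            rw [mul_one, lintegral_indicator hIm, lintegral_indicator hIm.compl,
              lintegral_add_compl _ hIm]
        _ ≤ 1 := ih.2

end

end RandSelfishKLUCB

/-! ### Deviation bounds for pull and success counts -/

namespace RandSelfishKLUCB

section

variable {Ω : Type*} {K : ℕ} {mΩ : MeasurableSpace Ω} {P : Measure Ω}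
  {μ : Fin K → unitInterval} {c : ℝ} {X Z : Fin K → ℕ → Ω → ℝ} {π : ℕ → Ω → Fin K}

open Classical in
/-- The number of rounds `s ∈ {1, …, t - 1}` in which arm `k` was selected and gave reward `1`. -/
noncomputable def successes (X : Fin K → ℕ → Ω → ℝ) (π : ℕ → Ω → Fin K) (k : Fin K) (t : ℕ)
    (ω : Ω) : ℕ :=
  ((Finset.Ico 1 t).filter (fun s => π s ω = k ∧ X k s ω = 1)).card

/-- At some time up to `T`, arm `k` has been selected `n` times, with `j` successes. -/
def visits (X : Fin K → ℕ → Ω → ℝ) (π : ℕ → Ω → Fin K) (k : Fin K) (T n j : ℕ) : Set Ω :=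
  {ω | ∃ t ∈ Finset.Icc 1 T, pulls π k t ω = n ∧ successes X π k t ω = j}

lemma successes_le_pulls (k : Fin K) (t : ℕ) (ω : Ω) : successes X π k t ω ≤ pulls π k t ω := by
  refine Finset.card_le_card fun s => ?_
  simp only [Finset.mem_filter]
  tauto

lemma pulls_mono (k : Fin K) (ω : Ω) {s t : ℕ} (hst : s ≤ t) :
    pulls π k s ω ≤ pulls π k t ω :=
  Finset.card_le_card (Finset.filter_subset_filter _ (Finset.Ico_subset_Ico le_rfl hst))

lemma pulls_succ (k : Fin K) {t : ℕ} (ht : 1 ≤ t) (ω : Ω) :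
    pulls π k (t + 1) ω = pulls π k t ω + if π t ω = k then 1 else 0 := by
  rw [pulls, pulls, Finset.card_filter, Finset.card_filter, Finset.sum_Ico_succ_top ht]

lemma pulls_lt_pulls (k : Fin K) {ω : Ω} {s t : ℕ} (hs : 1 ≤ s) (hst : s < t)
    (h : π s ω = k) : pulls π k s ω < pulls π k t ω := by
  have := pulls_succ (π := π) k hs ω
  rw [if_pos h] at this
  have := pulls_mono (π := π) k ω hst
  simp only [Nat.succ_eq_add_one] at this
  omega

lemma pulls_le (k : Fin K) (t : ℕ) (ω : Ω) : pulls π k t ω ≤ t - 1 :=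
  (Finset.card_filter_le _ _).trans (by simp)

lemma empMean_eq (k : Fin K) (t : ℕ) {ω : Ω}
    (h : ∀ s, 1 ≤ s → X k s ω = 1 ∨ X k s ω = 0) :
    empMean X π k t ω = (successes X π k t ω : ℝ) / (max (pulls π k t ω) 1 : ℕ) := by
  classical
  rw [empMean, successes, Finset.card_filter]
  congr 1
  push_cast
  refine Finset.sum_congr rfl fun s hs => ?_
  by_cases hk : π s ω = k
  · rcases h s (Finset.mem_Ico.1 hs).1 with h1 | h1 <;> simp [hk, reward, h1]
  · simp [hk]

lemma measurable_pulls (hπ : ∀ t, 1 ≤ t → Measurable[history X Z t] (π t)) (k : Fin K) (t : ℕ) :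
    Measurable[history X Z t] (pulls π k t) := by
  have : pulls π k t = fun ω => ∑ s ∈ Finset.Ico 1 t, if π s ω = k then 1 else 0 := by
    funext ω
    rw [pulls, Finset.card_filter]
  rw [this]
  refine Finset.measurable_fun_sum _ fun s hs => ?_
  obtain ⟨h1, h2⟩ := Finset.mem_Ico.1 hs
  exact Measurable.ite (history_mono h2.le _ (hπ s h1 (measurableSet_singleton k)))
    measurable_const measurable_const

lemma measurable_successes (hπ : ∀ t, 1 ≤ t → Measurable[history X Z t] (π t)) (k : Fin K)
    (t : ℕ) : Measurable[history X Z t] (successes X π k t) := by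
  classical
  have : successes X π k t =
      fun ω => ∑ s ∈ Finset.Ico 1 t, if π s ω = k ∧ X k s ω = 1 then 1 else 0 := by
    funext ω
    rw [successes, Finset.card_filter]
  rw [this]
  refine Finset.measurable_fun_sum _ fun s hs => ?_
  obtain ⟨h1, h2⟩ := Finset.mem_Ico.1 hs
  refine Measurable.ite (MeasurableSet.inter
    (history_mono h2.le _ (hπ s h1 (measurableSet_singleton k)))
    (measurable_X_history k h2 (measurableSet_singleton 1))) measurable_const measurable_const

/-- Betting stops once the arm has `n` pulls, so the capital at the fixed horizon `T` still shows
its value at the random time `t`. -/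
lemma capital_eq (k : Fin K) {ω : Ω} {t T n j : ℕ} (ht : t ∈ Finset.Icc 1 T)
    (hn : pulls π k t ω = n) (hj : successes X π k t ω = j) (a b : ENNReal) :
    capital X k (fun s => {ω | π s ω = k ∧ pulls π k s ω < n}) a b T ω = a ^ j * b ^ (n - j) := by
  classical
  obtain ⟨h1, h2⟩ := Finset.mem_Icc.1 ht
  rw [capital, ← Finset.prod_Ico_consecutive _ h1 h2]
  have e2 : ∀ s ∈ Finset.Ico t T, ω ∉ {ω | π s ω = k ∧ pulls π k s ω < n} := by
    rintro s hs ⟨-, h⟩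
    have := pulls_mono (π := π) k ω (Finset.mem_Ico.1 hs).1
    omega
  have e1 : ∀ s ∈ Finset.Ico 1 t, (ω ∈ {ω | π s ω = k ∧ pulls π k s ω < n} ↔ π s ω = k) :=
    fun s hs => ⟨fun h => h.1, fun hk => ⟨hk, hn ▸ pulls_lt_pulls k (Finset.mem_Ico.1 hs).1
      (Finset.mem_Ico.1 hs).2 hk⟩⟩
  refine (congrArg₂ (fun x y : ENNReal => x * y) (Finset.prod_congr rfl
    (g := fun s => if π s ω = k then (if X k s ω = 1 then a else b) else 1) fun s hs => ?_)
    (Finset.prod_eq_one fun s hs => ?_)).trans ?_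
  · by_cases hk : π s ω = k
    · rw [if_pos ((e1 s hs).2 hk), if_pos hk, betFactor]
    · rw [if_neg (fun h => hk ((e1 s hs).1 h)), if_neg hk]
  · exact if_neg (e2 s hs)
  rw [← Finset.prod_filter, mul_one, Finset.prod_ite, Finset.prod_const, Finset.prod_const,
    Finset.filter_filter]
  have hj' : ((Finset.Ico 1 t).filter (fun s => π s ω = k ∧ X k s ω = 1)).card = j := by
    rw [← hj, successes]
  have hadd := Finset.card_filter_add_card_filter_not
    (s := (Finset.Ico 1 t).filter (fun s => π s ω = k)) (fun s => X k s ω = 1)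
  rw [Finset.filter_filter, hj'] at hadd
  have hn' : ((Finset.Ico 1 t).filter (fun s => π s ω = k)).card = n := hn
  rw [hj']
  congr 2
  omega

lemma measurableSet_visits (henv : IsEnvironment P μ X Z)
    (hπ : ∀ t, 1 ≤ t → Measurable[history X Z t] (π t)) (k : Fin K) (T n j : ℕ) :
    MeasurableSet (visits X π k T n j) := by
  have : visits X π k T n j = ⋃ t ∈ Finset.Icc 1 T,
      (pulls π k t ⁻¹' {n} ∩ successes X π k t ⁻¹' {j}) := by
    ext ω
    simp [visits, and_left_comm]
  rw [this]
  exact Finset.measurableSet_biUnion _ fun t _ => henv.history_le t _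
    ((measurable_pulls hπ k t (measurableSet_singleton n)).inter
      (measurable_successes hπ k t (measurableSet_singleton j)))

/-- Markov's inequality for the stopped capital. -/
lemma measureReal_visits_mul_le [IsProbabilityMeasure P] (henv : IsEnvironment P μ X Z)
    (hπ : ∀ t, 1 ≤ t → Measurable[history X Z t] (π t)) (k : Fin K) (T n j : ℕ) {a b : ℝ}
    (ha : 0 ≤ a) (hb : 0 ≤ b) (hab : a * μ k + b * (1 - μ k) ≤ 1) :
    a ^ j * b ^ (n - j) * P.real (visits X π k T n j) ≤ 1 := by
  have hI : ∀ s, 1 ≤ s → MeasurableSet[history X Z s] {ω | π s ω = k ∧ pulls π k s ω < n} :=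
    fun s hs => (hπ s hs (measurableSet_singleton k)).inter
      (measurable_pulls hπ k s (measurableSet_Iio (a := n)))
  obtain ⟨hm, hle⟩ := henv.lintegral_capital_le k hI (a := ENNReal.ofReal a)
    (b := ENNReal.ofReal b) (by
      rw [← ENNReal.ofReal_mul ha, ← ENNReal.ofReal_mul hb, ← ENNReal.ofReal_add
        (mul_nonneg ha (μ k).2.1) (mul_nonneg hb (sub_nonneg.2 (μ k).2.2))]
      exact ENNReal.ofReal_le_one.2 hab) T
  have hM := mul_meas_ge_le_lintegral₀ (μ := P) (hm.mono (henv.history_le T) le_rfl).aemeasurable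
    (ENNReal.ofReal a ^ j * ENNReal.ofReal b ^ (n - j))
  have hsub : visits X π k T n j ⊆ {ω | ENNReal.ofReal a ^ j * ENNReal.ofReal b ^ (n - j) ≤
      capital X k (fun s => {ω | π s ω = k ∧ pulls π k s ω < n}) (ENNReal.ofReal a)
        (ENNReal.ofReal b) T ω} := by
    rintro ω ⟨t, ht, hn, hj⟩
    exact (capital_eq k ht hn hj _ _).ge
  have hfin := (mul_le_mul_right (measure_mono (μ := P) hsub) _).trans (hM.trans hle)
  rw [← ENNReal.ofReal_pow ha, ← ENNReal.ofReal_pow hb,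
    ← ENNReal.ofReal_mul (pow_nonneg ha _)] at hfin
  have := ENNReal.toReal_mono ENNReal.one_ne_top hfin
  rwa [ENNReal.toReal_mul, ENNReal.toReal_ofReal (by positivity), ENNReal.toReal_one] at this

/-- Chernoff bound: the factors are `exp(l (x - m) - l²)` for `x = 1, 0`, fair or worse because `exp
x ≤ 1 + x + x²` bounds the centred moment generating function by `exp(l²)`. -/
lemma measureReal_visits_le_of_mean_lt [IsProbabilityMeasure P] (henv : IsEnvironment P μ X Z)
    (hπ : ∀ t, 1 ≤ t → Measurable[history X Z t] (π t)) (k : Fin K) (T : ℕ) {n j : ℕ}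
    (hj : j ≤ n) {p : ℝ} (hp : (μ k : ℝ) < p) (hp1 : p ≤ 1) (hnj : n * p ≤ j) :
    P.real (visits X π k T n j) ≤ Real.exp (-((p - μ k) ^ 2 / 4 * n)) := by
  set m := ((μ k : unitInterval) : ℝ) with hm
  have hm0 : 0 ≤ m := (μ k).2.1
  -- This value maximizes the exponent `l (p - m) - l²`.
  obtain ⟨l, hl⟩ : ∃ l, l = (p - m) / 2 := ⟨_, rfl⟩
  have hl0 : 0 < l := by rw [hl]; linarith
  have hl1 : l ≤ 1 := by rw [hl]; linarith
  have hquad : ∀ x : ℝ, |x| ≤ 1 → Real.exp x ≤ 1 + x + x ^ 2 := fun x hx => by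
    have := (abs_le.1 (Real.abs_exp_sub_one_sub_id_le hx)).2
    linarith
  have h1 := hquad (l * (1 - m)) (abs_le.2 ⟨by nlinarith, by nlinarith⟩)
  have h2 := hquad (-(l * m)) (abs_le.2 ⟨by nlinarith, by nlinarith⟩)
  have h3 : Real.exp (l * (1 - m)) * m + Real.exp (-(l * m)) * (1 - m) ≤ Real.exp (l ^ 2) := by
    have e1 := mul_le_mul_of_nonneg_right h1 hm0
    have e2 := mul_le_mul_of_nonneg_right h2 (by linarith : 0 ≤ 1 - m)
    have e3 := Real.add_one_le_exp (l ^ 2)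
    have e4 : l ^ 2 * (m * (1 - m)) ≤ l ^ 2 * 1 :=
      mul_le_mul_of_nonneg_left (by nlinarith) (sq_nonneg l)
    nlinarith
  have h4 := measureReal_visits_mul_le henv hπ k T n j
    (a := Real.exp (l * (1 - m) - l ^ 2)) (b := Real.exp (-(l * m) - l ^ 2))
    (Real.exp_pos _).le (Real.exp_pos _).le (by
      rw [← hm, Real.exp_sub, Real.exp_sub, div_mul_eq_mul_div, div_mul_eq_mul_div, ← add_div]
      exact (div_le_one (Real.exp_pos _)).2 h3)
  rw [← Real.exp_nat_mul, ← Real.exp_nat_mul, ← Real.exp_add, Nat.cast_sub hj, mul_comm,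
    ← le_div_iff₀ (Real.exp_pos _), one_div, ← Real.exp_neg] at h4
  refine h4.trans (Real.exp_le_exp.2 ?_)
  have e5 : l * (n * p) ≤ l * j := mul_le_mul_of_nonneg_left hnj hl0.le
  have e6 : p = m + 2 * l := by rw [hl]; ring
  rw [e6] at e5 ⊢
  nlinarith

/-- The bet is the likelihood ratio of `j / n` against an intermediate `r`. As the true mean is
above `r`, the bet loses on average, so its factors can be inflated by `exp κ`. Betting against `q`
itself would leave no uniform gain, since `j / n` may be close to `q`; against `r` the margin is at
least `r - q`. -/
lemma measureReal_visits_le_of_lt_mean [IsProbabilityMeasure P] (henv : IsEnvironment P μ X Z)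
    (hπ : ∀ t, 1 ≤ t → Measurable[history X Z t] (π t)) (k : Fin K) (T : ℕ) {n j : ℕ}
    (hj : j ≤ n) (hn : 0 < n) {q r : ℝ} (hqr : q < r) (hr : r < μ k) (hjq : (j / n : ℝ) < q) :
    P.real (visits X π k T n j)
      ≤ Real.exp (-(n * klReal (j / n) q) - (r - q) * (μ k - r) * n) := by
  set m := ((μ k : unitInterval) : ℝ) with hm
  have hm1 : m ≤ 1 := (μ k).2.2
  have hp0 : (0 : ℝ) ≤ j / n := by positivity
  obtain ⟨κ, hκ⟩ : ∃ κ, κ = (r - q) * (m - r) := ⟨_, rfl⟩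
  obtain ⟨p, hp⟩ : ∃ p : ℝ, p = j / n := ⟨_, rfl⟩
  have hpp := pow_mul_pow_eq_exp_klReal hj hn (q := r) (by linarith) (by linarith)
  rw [← hp] at hpp hp0 hjq ⊢
  have hr0 : 0 < r := by linarith
  have hr1 : 0 < 1 - r := by linarith
  have hlin : p / r * m + (1 - p) / (1 - r) * (1 - m) ≤ Real.exp (-κ) := by
    have e1 : p / r * m + (1 - p) / (1 - r) * (1 - m) = 1 - (m - r) * (r - p) / (r * (1 - r)) := by
      field_simp
      ring
    have e2 : κ ≤ (m - r) * (r - p) / (r * (1 - r)) := by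
      rw [le_div_iff₀ (by positivity), hκ]
      have h1 : (r - q) * (m - r) ≤ (m - r) * (r - p) := by nlinarith
      have h2 : 0 ≤ (r - q) * (m - r) := mul_nonneg (by linarith) (by linarith)
      have h3 : r * (1 - r) ≤ 1 := by nlinarith
      nlinarith
    have := Real.add_one_le_exp (-κ)
    linarith
  have h4 := measureReal_visits_mul_le henv hπ k T n j
    (a := p / r * Real.exp κ) (b := (1 - p) / (1 - r) * Real.exp κ)
    (by positivity) (mul_nonneg (div_nonneg (by linarith) hr1.le) (Real.exp_pos _).le) (by
      rw [← hm]
      calc _ = (p / r * m + (1 - p) / (1 - r) * (1 - m)) * Real.exp κ := by ring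
        _ ≤ Real.exp (-κ) * Real.exp κ := by gcongr
        _ = 1 := by rw [← Real.exp_add]; simp)
  have h5 : (p / r * Real.exp κ) ^ j * ((1 - p) / (1 - r) * Real.exp κ) ^ (n - j)
      = Real.exp (n * klReal p r + n * κ) := by
    have : Real.exp κ ^ n = Real.exp κ ^ j * Real.exp κ ^ (n - j) := by
      rw [← pow_add]; congr 1; omega
    rw [Real.exp_add, ← hpp, Real.exp_nat_mul, this, mul_pow, mul_pow]
    ring
  rw [h5, mul_comm, ← le_div_iff₀ (Real.exp_pos _), one_div, ← Real.exp_neg] at h4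
  refine h4.trans (Real.exp_le_exp.2 ?_)
  have := klReal_mono_right hp0 hjq.le (by linarith) hqr.le (by linarith)
  have := mul_le_mul_of_nonneg_left this (Nat.cast_nonneg (α := ℝ) n)
  rw [← hκ]
  linarith

end

end RandSelfishKLUCB

/-! ### Decomposition of the pulls of a suboptimal arm -/

namespace RandSelfishKLUCB

section

variable {Ω : Type*} {K : ℕ} {mΩ : MeasurableSpace Ω} {P : Measure Ω}
  {μ : Fin K → unitInterval} {c : ℝ} {X Z : Fin K → ℕ → Ω → ℝ} {π : ℕ → Ω → Fin K}

/-- The perturbation of arm `k` in round `t` exceeds `δ`. -/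
def largeNoise (Z : Fin K → ℕ → Ω → ℝ) (k : Fin K) (δ : ℝ) (t : ℕ) : Set Ω :=
  {ω | δ * t ≤ |Z k t ω|}

open Classical in
/-- The statistics of arm `k` at some time up to `t` make its index at exploration level
`explore c t` smaller than `q`. -/
noncomputable def lowIndex (c : ℝ) (X : Fin K → ℕ → Ω → ℝ) (π : ℕ → Ω → Fin K) (k : Fin K)
    (q : ℝ) (t : ℕ) : Set Ω :=
  ⋃ n ∈ Finset.Icc 1 t, ⋃ j ∈ (Finset.range (n + 1)).filter
    (fun j : ℕ => (j / n : ℝ) < q ∧ explore c t < n * klReal (j / n) q), visits X π k t n j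

open Classical in
/-- The empirical mean of arm `k` after `n` selections is at least `p`. -/
noncomputable def highMean (X : Fin K → ℕ → Ω → ℝ) (π : ℕ → Ω → Fin K) (k : Fin K)
    (p : ℝ) (T n : ℕ) : Set Ω :=
  ⋃ j ∈ (Finset.range (n + 1)).filter (fun j : ℕ => n * p ≤ j), visits X π k T n j

lemma card_filter_eq_sum_indicator (s : Finset ℕ) (A : ℕ → Set Ω) (ω : Ω)
    [DecidablePred fun t => ω ∈ A t] :
    ((s.filter (fun t => ω ∈ A t)).card : ℝ) = ∑ t ∈ s, (A t).indicator (fun _ => (1 : ℝ)) ω := by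
  rw [Finset.card_filter]
  push_cast
  exact Finset.sum_congr rfl fun t _ => by simp [Set.indicator_apply]

lemma empMean_mem_Icc (k : Fin K) (t : ℕ) {ω : Ω}
    (h : ∀ s, 1 ≤ s → X k s ω = 1 ∨ X k s ω = 0) :
    0 ≤ empMean X π k t ω ∧ empMean X π k t ω ≤ 1 := by
  rw [empMean_eq k t h]
  have hpos : (0 : ℝ) < (max (pulls π k t ω) 1 : ℕ) := by
    exact_mod_cast lt_of_lt_of_le one_pos (le_max_right _ _)
  refine ⟨by positivity, (div_le_one hpos).2 ?_⟩
  exact_mod_cast (successes_le_pulls k t ω).trans (le_max_left _ _)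

lemma mem_lowIndex (hc : 0 ≤ c) (k : Fin K) {t : ℕ} (ht : 3 ≤ t) {ω : Ω}
    (h : ∀ s, 1 ≤ s → X k s ω = 1 ∨ X k s ω = 0) {q : ℝ} (h0 : 0 < q) (h1 : q < 1)
    (hlt : klIndex (pulls π k t ω) (empMean X π k t ω) (explore c t) < q) :
    ω ∈ lowIndex c X π k q t := by
  obtain ⟨hp0, hp1⟩ := empMean_mem_Icc (π := π) k t h
  obtain ⟨hpq, hf⟩ := of_klIndex_lt hp0 hp1 (explore_nonneg hc ht) h0 h1 hlt
  have hn : 1 ≤ pulls π k t ω := by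
    by_contra! hn
    have : pulls π k t ω = 0 := by omega
    rw [this, Nat.cast_zero, zero_mul] at hf
    exact absurd (explore_nonneg hc ht) (not_le.2 hf)
  rw [empMean_eq k t h, max_eq_left hn] at hpq hf
  simp only [lowIndex, Set.mem_iUnion]
  refine ⟨pulls π k t ω, Finset.mem_Icc.2 ⟨hn, (pulls_le k t ω).trans (Nat.sub_le _ _)⟩,
    successes X π k t ω, Finset.mem_filter.2 ⟨Finset.mem_range.2
      (Nat.lt_succ_of_le (successes_le_pulls k t ω)), hpq, hf⟩, t, ?_, rfl, rfl⟩
  exact Finset.mem_Icc.2 ⟨by omega, le_rfl⟩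

/-- If the empirical mean were below `p`, its divergence to `q` would be at least `klReal p q`, and
an index above `q` would force `n * klReal p q ≤ explore c T`. -/
lemma mem_highMean (hc : 0 ≤ c) (k : Fin K) {t T : ℕ} (ht : 3 ≤ t) (htT : t ≤ T) {ω : Ω}
    (h : ∀ s, 1 ≤ s → X k s ω = 1 ∨ X k s ω = 0) {p q : ℝ} (h0 : 0 < p) (hpq : p < q)
    (h1 : q < 1) (hlt : q < klIndex (pulls π k t ω) (empMean X π k t ω) (explore c t))
    (hn : explore c T / klReal p q < pulls π k t ω) :
    ω ∈ highMean X π k p T (pulls π k t ω) := by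
  have hkl := klReal_pos h0.le hpq h1
  have hn0 : (0 : ℝ) < pulls π k t ω :=
    (div_nonneg (explore_nonneg hc (ht.trans htT)) hkl.le).trans_lt hn
  have hn1 : 1 ≤ pulls π k t ω := by exact_mod_cast hn0
  obtain ⟨hp0, -⟩ := empMean_mem_Icc (π := π) k t h
  rw [empMean_eq k t h, max_eq_left hn1] at hp0 hlt
  simp only [highMean, Set.mem_iUnion]
  refine ⟨successes X π k t ω, Finset.mem_filter.2 ⟨Finset.mem_range.2
      (Nat.lt_succ_of_le (successes_le_pulls k t ω)), ?_⟩, t,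
      Finset.mem_Icc.2 ⟨by omega, htT⟩, rfl, rfl⟩
  by_contra! hjp
  rw [mul_comm, ← div_lt_iff₀ hn0] at hjp
  have e1 := mul_klReal_le_of_lt_klIndex hp0 (hjp.trans hpq) (explore_nonneg hc ht) h1 hlt
  have e2 := klReal_anti_left hp0 hjp.le h0 hpq.le h1
  rw [div_lt_iff₀ hkl] at hn
  have e3 := mul_le_mul_of_nonneg_left e2 hn0.le
  have e4 := explore_mono hc ht htT
  linarith

/-- A pathwise count. The constant 3 covers rounds 1 and 2 and the value `n = 0`. -/
lemma pulls_le_sum_indicator (hc : 0 ≤ c) (k i : Fin K) {ω : Ω}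
    (hk : ∀ s, 1 ≤ s → X k s ω = 1 ∨ X k s ω = 0)
    (hi : ∀ s, 1 ≤ s → X i s ω = 1 ∨ X i s ω = 0)
    (hmax : ∀ t, 3 ≤ t → perturbedIndex c X Z π i t ω ≤ perturbedIndex c X Z π (π t ω) t ω)
    {p q δ : ℝ} (h0 : 0 < p) (hpq : p < q) (hδ : 0 < δ) (h1 : q + 2 * δ < 1) {T : ℕ}
    (hT : 3 ≤ T) :
    (pulls π k T ω : ℝ) ≤ 3 + explore c T / klReal p q
      + ∑ t ∈ Finset.Ico 3 T, ((largeNoise Z k δ t).indicator (fun _ => (1 : ℝ)) ω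
        + (largeNoise Z i δ t).indicator (fun _ => (1 : ℝ)) ω
        + (lowIndex c X π i (q + 2 * δ) t).indicator (fun _ => (1 : ℝ)) ω)
      + ∑ n ∈ Finset.range T, (highMean X π k p T n).indicator (fun _ => (1 : ℝ)) ω := by
  classical
  have hn0 : 0 ≤ explore c T / klReal p q :=
    div_nonneg (explore_nonneg hc hT) (klReal_pos h0.le hpq (by linarith)).le
  set R := (Finset.Ico 3 T).filter (fun t => π t ω = k ∧
    q < klIndex (pulls π k t ω) (empMean X π k t ω) (explore c t)) with hR
  have hRcard : R.card ≤ (Finset.range (⌊explore c T / klReal p q⌋₊ + 1) ∪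
      (Finset.range T).filter (fun n => ω ∈ highMean X π k p T n)).card := by
    -- Each selection of `k` raises its pull count, so rounds in `R` may be counted by that value.
    refine Finset.card_le_card_of_injOn (fun t => pulls π k t ω) ?_ ?_
    · intro t ht
      obtain ⟨ht1, -, ht3⟩ := Finset.mem_filter.1 (Finset.mem_coe.1 ht)
      obtain ⟨ht4, ht5⟩ := Finset.mem_Ico.1 ht1
      rw [Finset.mem_coe, Finset.mem_union]
      by_cases hn : explore c T / klReal p q < pulls π k t ω
      · refine Or.inr (Finset.mem_filter.2 ⟨Finset.mem_range.2 ?_,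
          mem_highMean hc k ht4 ht5.le hk h0 hpq (by linarith) ht3 hn⟩)
        have := pulls_le (π := π) k t ω
        exact this.trans_lt (by omega)
      · exact Or.inl (Finset.mem_range.2 (Nat.lt_succ_of_le (Nat.le_floor (not_lt.1 hn))))
    · intro s hs t ht hst
      obtain ⟨hs1, hs2, -⟩ := Finset.mem_filter.1 (Finset.mem_coe.1 hs)
      obtain ⟨ht1, ht2, -⟩ := Finset.mem_filter.1 (Finset.mem_coe.1 ht)
      have hs3 := (Finset.mem_Ico.1 hs1).1
      have ht3 := (Finset.mem_Ico.1 ht1).1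
      rcases lt_trichotomy s t with h | h | h
      · exact absurd hst (pulls_lt_pulls k (by omega) h hs2).ne
      · exact h
      · exact absurd hst (pulls_lt_pulls k (by omega) h ht2).ne'
  have hsub : (Finset.Ico 1 T).filter (fun s => π s ω = k) ⊆
      {1, 2} ∪ (((Finset.Ico 3 T).filter (fun t => ω ∈ largeNoise Z k δ t) ∪
        (Finset.Ico 3 T).filter (fun t => ω ∈ largeNoise Z i δ t)) ∪
        (Finset.Ico 3 T).filter (fun t => ω ∈ lowIndex c X π i (q + 2 * δ) t)) ∪ R := by
    intro t ht
    obtain ⟨ht1, ht2⟩ := Finset.mem_filter.1 ht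
    obtain ⟨ht3, ht4⟩ := Finset.mem_Ico.1 ht1
    by_cases ht5 : t < 3
    · refine Finset.mem_union_left _ (Finset.mem_union_left _ ?_)
      rw [Finset.mem_insert, Finset.mem_singleton]
      omega
    have ht6 : t ∈ Finset.Ico 3 T := Finset.mem_Ico.2 ⟨by omega, ht4⟩
    by_contra hnot
    simp only [Finset.mem_union, not_or, hR, Finset.mem_filter, ht6, ht2, true_and, not_lt] at hnot
    obtain ⟨⟨-, ⟨hZk, hZi⟩, hlow⟩, hkl⟩ := hnot
    -- Outside all the listed events arm `i` scores above `q + δ` and arm `k` below it, against the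
    -- argmax rule.
    have e1 : q + 2 * δ ≤ klIndex (pulls π i t ω) (empMean X π i t ω) (explore c t) := by
      by_contra! hlt
      exact hlow (mem_lowIndex hc i (by omega) hi (by linarith) h1 hlt)
    have e2 := hmax t (by omega)
    rw [ht2, perturbedIndex, perturbedIndex] at e2
    have ht0 : (0 : ℝ) < t := by exact_mod_cast (by omega : 0 < t)
    have hZk' : |Z k t ω| < δ * t := not_le.1 hZk
    have hZi' : |Z i t ω| < δ * t := not_le.1 hZi
    have e3 : Z k t ω / t < δ := (div_lt_iff₀ ht0).2 ((le_abs_self _).trans_lt hZk')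
    have e4 : -δ < Z i t ω / t := by
      rw [lt_div_iff₀ ht0, neg_mul]
      linarith [neg_abs_le (Z i t ω)]
    linarith
  have hcard := Finset.card_le_card hsub
  have u1 := Finset.card_union_le ({1, 2} ∪ (((Finset.Ico 3 T).filter
    (fun t => ω ∈ largeNoise Z k δ t) ∪ (Finset.Ico 3 T).filter
    (fun t => ω ∈ largeNoise Z i δ t)) ∪ (Finset.Ico 3 T).filter
    (fun t => ω ∈ lowIndex c X π i (q + 2 * δ) t))) R
  have u2 := Finset.card_union_le {1, 2} (((Finset.Ico 3 T).filter
    (fun t => ω ∈ largeNoise Z k δ t) ∪ (Finset.Ico 3 T).filter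
    (fun t => ω ∈ largeNoise Z i δ t)) ∪ (Finset.Ico 3 T).filter
    (fun t => ω ∈ lowIndex c X π i (q + 2 * δ) t))
  have u3 := Finset.card_union_le ((Finset.Ico 3 T).filter
    (fun t => ω ∈ largeNoise Z k δ t) ∪ (Finset.Ico 3 T).filter
    (fun t => ω ∈ largeNoise Z i δ t)) ((Finset.Ico 3 T).filter
    (fun t => ω ∈ lowIndex c X π i (q + 2 * δ) t))
  have u4 := Finset.card_union_le ((Finset.Ico 3 T).filter
    (fun t => ω ∈ largeNoise Z k δ t)) ((Finset.Ico 3 T).filter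
    (fun t => ω ∈ largeNoise Z i δ t))
  have u5 := Finset.card_union_le (Finset.range (⌊explore c T / klReal p q⌋₊ + 1))
    ((Finset.range T).filter (fun n => ω ∈ highMean X π k p T n))
  rw [Finset.card_range] at u5
  have u6 : ({1, 2} : Finset ℕ).card = 2 := rfl
  have hpulls : pulls π k T ω ≤ 3 + ⌊explore c T / klReal p q⌋₊
      + ((Finset.Ico 3 T).filter (fun t => ω ∈ largeNoise Z k δ t)).card
      + ((Finset.Ico 3 T).filter (fun t => ω ∈ largeNoise Z i δ t)).card
      + ((Finset.Ico 3 T).filter (fun t => ω ∈ lowIndex c X π i (q + 2 * δ) t)).card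
      + ((Finset.range T).filter (fun n => ω ∈ highMean X π k p T n)).card := by
    rw [pulls]
    omega
  have hpulls' : (pulls π k T ω : ℝ) ≤ 3 + ⌊explore c T / klReal p q⌋₊
      + ((Finset.Ico 3 T).filter (fun t => ω ∈ largeNoise Z k δ t)).card
      + ((Finset.Ico 3 T).filter (fun t => ω ∈ largeNoise Z i δ t)).card
      + ((Finset.Ico 3 T).filter (fun t => ω ∈ lowIndex c X π i (q + 2 * δ) t)).card
      + ((Finset.range T).filter (fun n => ω ∈ highMean X π k p T n)).card := by
    exact_mod_cast hpulls
  simp only [card_filter_eq_sum_indicator] at hpulls'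
  rw [Finset.sum_add_distrib, Finset.sum_add_distrib]
  linarith [Nat.floor_le hn0]

/-! ### Summable bounds for the exceptional events -/

lemma measurableSet_largeNoise (henv : IsEnvironment P μ X Z) (k : Fin K) (δ : ℝ) (t : ℕ) :
    MeasurableSet (largeNoise Z k δ t) :=
  measurableSet_le measurable_const (measurable_abs.comp (henv.measurable_Z k t))

lemma measurableSet_lowIndex (henv : IsEnvironment P μ X Z)
    (hπ : ∀ t, 1 ≤ t → Measurable[history X Z t] (π t)) (k : Fin K) (q : ℝ) (t : ℕ) :
    MeasurableSet (lowIndex c X π k q t) :=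
  Finset.measurableSet_biUnion _ fun n _ => Finset.measurableSet_biUnion _ fun j _ =>
    measurableSet_visits henv hπ k t n j

lemma measurableSet_highMean (henv : IsEnvironment P μ X Z)
    (hπ : ∀ t, 1 ≤ t → Measurable[history X Z t] (π t)) (k : Fin K) (p : ℝ) (T n : ℕ) :
    MeasurableSet (highMean X π k p T n) :=
  Finset.measurableSet_biUnion _ fun j _ => measurableSet_visits henv hπ k T n j

lemma measureReal_largeNoise_le [IsProbabilityMeasure P] (henv : IsEnvironment P μ X Z)
    (k : Fin K) {δ : ℝ} (hδ : 0 < δ) {t : ℕ} (ht : 1 ≤ t) :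
    P.real (largeNoise Z k δ t) ≤ (δ ^ 2)⁻¹ * (1 / (t : ℝ) ^ 2) := by
  have ht0 : (0 : ℝ) < t := by exact_mod_cast ht
  have hlaw := henv.law_Z k t ht
  have hset : MeasurableSet {x : ℝ | δ * t ≤ |x|} :=
    measurableSet_le measurable_const measurable_abs
  have h := meas_ge_le_variance_div_sq (memLp_id_gaussianReal (μ := 0) (v := 1) 2)
    (mul_pos hδ ht0)
  rw [variance_id_gaussianReal] at h
  simp only [id, integral_id_gaussianReal, sub_zero] at h
  rw [largeNoise, hlaw.measureReal_eq (p := fun x => δ * t ≤ |x|) hset]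
  have h2 := ENNReal.toReal_mono ENNReal.ofReal_ne_top h
  rw [ENNReal.toReal_ofReal (by positivity)] at h2
  refine h2.trans (le_of_eq ?_)
  field_simp
  simp

/-- Union bound over at most `n + 1` success counts. -/
lemma measureReal_highMean_le [IsProbabilityMeasure P] (henv : IsEnvironment P μ X Z)
    (hπ : ∀ t, 1 ≤ t → Measurable[history X Z t] (π t)) (k : Fin K) {p : ℝ}
    (hp : (μ k : ℝ) < p) (hp1 : p ≤ 1) (T n : ℕ) :
    P.real (highMean X π k p T n) ≤ (n + 1) * Real.exp (-((p - μ k) ^ 2 / 4 * n)) := by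
  classical
  refine (measureReal_biUnion_finset_le _ _).trans ((Finset.sum_le_card_nsmul _ _
    (Real.exp (-((p - μ k) ^ 2 / 4 * n))) ?_).trans ?_)
  · intro j hj
    obtain ⟨h1, h2⟩ := Finset.mem_filter.1 hj
    exact measureReal_visits_le_of_mean_lt henv hπ k T
      (Nat.le_of_lt_succ (Finset.mem_range.1 h1)) hp hp1 h2
  · rw [nsmul_eq_mul]
    refine mul_le_mul_of_nonneg_right ?_ (Real.exp_pos _).le
    have := Finset.card_filter_le (Finset.range (n + 1)) (fun j : ℕ => n * p ≤ j)
    rw [Finset.card_range] at this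
    exact_mod_cast this

lemma summable_succ_mul_exp {κ : ℝ} (hκ : 0 < κ) :
    Summable (fun n : ℕ => ((n : ℝ) + 1) * Real.exp (-(κ * n))) := by
  have h1 := Real.summable_pow_mul_exp_neg_nat_mul 1 hκ
  have h0 := Real.summable_pow_mul_exp_neg_nat_mul 0 hκ
  refine (h1.add h0).congr fun n => ?_
  simp only [pow_one, pow_zero, one_mul, neg_mul]
  ring

/-- The exponent by which the bound on the probability of `lowIndex` improves on `1 / t`. -/
noncomputable def lowIndexGain (m q r : ℝ) : ℝ :=
  (r - q) * (m - r) / (2 * -Real.log (1 - q))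

lemma lowIndexGain_pos {m q r : ℝ} (h0 : 0 < q) (hqr : q < r) (hr : r < m) (hm : m ≤ 1) :
    0 < lowIndexGain m q r := by
  have : Real.log (1 - q) < 0 := Real.log_neg (by linarith) (by linarith)
  exact div_pos (mul_pos (by linarith) (by linarith)) (by linarith)

/-- The exponent is `n kl + κ n`. The first term exceeds `log t`; half of `κ n` makes the sum over
`n` and `j` converge; the other half becomes `g log t`, because `log t < n kl ≤ -n log(1 - q)`. -/
lemma measureReal_lowIndex_le [IsProbabilityMeasure P] (henv : IsEnvironment P μ X Z)
    (hπ : ∀ t, 1 ≤ t → Measurable[history X Z t] (π t)) (hc : 0 ≤ c) (k : Fin K) {q r : ℝ}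
    (h0 : 0 < q) (hqr : q < r) (hr : r < μ k) {t : ℕ} (ht : 3 ≤ t) :
    P.real (lowIndex c X π k q t) ≤
      (∑' n : ℕ, ((n : ℝ) + 1) * Real.exp (-((r - q) * (μ k - r) / 2 * n)))
        * (1 / (t : ℝ) ^ (1 + lowIndexGain (μ k) q r)) := by
  classical
  have hm1 : (μ k : ℝ) ≤ 1 := (μ k).2.2
  have ht0 : (0 : ℝ) < t := by exact_mod_cast (by omega : 0 < t)
  have hlog : Real.log (1 - q) < 0 := Real.log_neg (by linarith) (by linarith)
  have hκ : 0 < (r - q) * (μ k - r) / 2 :=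
    div_pos (mul_pos (by linarith) (by linarith)) two_pos
  have hg : (r - q) * (μ k - r) / 2 = lowIndexGain (μ k) q r * -Real.log (1 - q) := by
    have := hlog.ne
    rw [lowIndexGain]
    field_simp
  have hgpos := lowIndexGain_pos h0 hqr hr hm1
  have hbase : 1 / (t : ℝ) ^ (1 + lowIndexGain (μ k) q r)
      = Real.exp (-((1 + lowIndexGain (μ k) q r) * Real.log t)) := by
    rw [Real.rpow_def_of_pos ht0, one_div, ← Real.exp_neg, mul_comm]
  have hterm : ∀ n ∈ Finset.Icc 1 t, P.real (⋃ j ∈ (Finset.range (n + 1)).filter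
      (fun j : ℕ => (j / n : ℝ) < q ∧ explore c t < n * klReal (j / n) q), visits X π k t n j) ≤
      ((n : ℝ) + 1) * Real.exp (-((r - q) * (μ k - r) / 2 * n))
        * (1 / (t : ℝ) ^ (1 + lowIndexGain (μ k) q r)) := by
    intro n hn
    have hn1 := (Finset.mem_Icc.1 hn).1
    have hn0 : (0 : ℝ) < n := by exact_mod_cast hn1
    refine (measureReal_biUnion_finset_le _ _).trans ((Finset.sum_le_card_nsmul _ _
      (Real.exp (-((r - q) * (μ k - r) / 2 * n))
        * (1 / (t : ℝ) ^ (1 + lowIndexGain (μ k) q r))) ?_).trans ?_)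
    · intro j hj
      obtain ⟨h1, h2, h3⟩ := Finset.mem_filter.1 hj
      refine (measureReal_visits_le_of_lt_mean henv hπ k t
        (Nat.le_of_lt_succ (Finset.mem_range.1 h1)) hn1 hqr hr h2).trans ?_
      rw [hbase, ← Real.exp_add]
      refine Real.exp_le_exp.2 ?_
      have e1 := klReal_le_neg_log (by positivity) h2.le h0 (by linarith)
      have e2 := log_le_explore hc ht
      have e3 := mul_le_mul_of_nonneg_left e1 hn0.le
      have e4 : lowIndexGain (μ k) q r * Real.log t
          ≤ lowIndexGain (μ k) q r * (n * -Real.log (1 - q)) :=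
        mul_le_mul_of_nonneg_left (by linarith) hgpos.le
      have e5 : lowIndexGain (μ k) q r * (n * -Real.log (1 - q))
          = (r - q) * (μ k - r) / 2 * n := by rw [hg]; ring
      linarith
    · rw [nsmul_eq_mul, mul_assoc]
      refine mul_le_mul_of_nonneg_right ?_ (by positivity)
      have := Finset.card_filter_le (Finset.range (n + 1))
        (fun j : ℕ => (j / n : ℝ) < q ∧ explore c t < n * klReal (j / n) q)
      rw [Finset.card_range] at this
      exact_mod_cast this
  refine (measureReal_biUnion_finset_le _ _).trans ((Finset.sum_le_sum hterm).trans ?_)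
  rw [← Finset.sum_mul]
  refine mul_le_mul_of_nonneg_right ?_ (by positivity)
  exact (summable_succ_mul_exp hκ).sum_le_tsum _ fun n _ => by positivity

lemma integrable_pulls [IsProbabilityMeasure P] (henv : IsEnvironment P μ X Z)
    (hπ : ∀ t, 1 ≤ t → Measurable[history X Z t] (π t)) (k : Fin K) (T : ℕ) :
    Integrable (fun ω => (pulls π k T ω : ℝ)) P := by
  refine Integrable.of_bound (C := T) ((measurable_from_top.comp
    ((measurable_pulls hπ k T).mono (henv.history_le T) le_rfl)).aestronglyMeasurable) ?_
  refine ae_of_all _ fun ω => ?_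
  rw [Real.norm_of_nonneg (Nat.cast_nonneg _)]
  exact_mod_cast (pulls_le k T ω).trans (Nat.sub_le _ _)

theorem exists_integral_pulls_le [IsProbabilityMeasure P] (henv : IsEnvironment P μ X Z)
    (hrun : IsRun P c X Z π) (hc : 0 ≤ c) (k i : Fin K) {p q : ℝ} (hp : (μ k : ℝ) < p)
    (hpq : p < q) (hq : q < μ i) :
    ∃ C, ∀ T, 3 ≤ T → ∫ ω, (pulls π k T ω : ℝ) ∂P ≤ explore c T / klReal p q + C := by
  have hk0 : (0 : ℝ) ≤ μ k := (μ k).2.1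
  have hi1 : (μ i : ℝ) ≤ 1 := (μ i).2.2
  -- With this step, `q < q + 2δ < q + 4δ < q + 6δ = μ i`: noise margin, low-index level, betting
  -- level, true mean.
  obtain ⟨δ, hδ⟩ : ∃ δ, δ = (μ i - q) / 6 := ⟨_, rfl⟩
  have hδ0 : 0 < δ := by rw [hδ]; linarith
  have hπ := hrun.adapted
  have hr1 : q + 2 * δ < q + 4 * δ := by linarith
  have hr2 : q + 4 * δ < μ i := by rw [hδ]; linarith
  set g := lowIndexGain (μ i) (q + 2 * δ) (q + 4 * δ) with hg
  have hg0 : 0 < g := lowIndexGain_pos (by linarith) hr1 hr2 hi1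
  set S := ∑' n : ℕ, ((n : ℝ) + 1) *
    Real.exp (-((q + 4 * δ - (q + 2 * δ)) * (μ i - (q + 4 * δ)) / 2 * n)) with hS
  have hκ : 0 < (p - μ k) ^ 2 / 4 := by
    have : 0 < p - μ k := by linarith
    positivity
  have hs1 : Summable (fun t : ℕ => (δ ^ 2)⁻¹ * (1 / (t : ℝ) ^ 2)) :=
    (Real.summable_one_div_nat_pow.2 (by norm_num)).mul_left _
  have hs2 : Summable (fun t : ℕ => S * (1 / (t : ℝ) ^ (1 + g))) :=
    (Real.summable_one_div_nat_rpow.2 (by linarith)).mul_left _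
  have hs3 := summable_succ_mul_exp hκ
  have hS0 : 0 ≤ S := tsum_nonneg fun n => by positivity
  refine ⟨3 + ((∑' t : ℕ, (δ ^ 2)⁻¹ * (1 / (t : ℝ) ^ 2)) + (∑' t : ℕ, (δ ^ 2)⁻¹ * (1 / (t : ℝ) ^ 2))
    + ∑' t : ℕ, S * (1 / (t : ℝ) ^ (1 + g)))
    + ∑' n : ℕ, ((n : ℝ) + 1) * Real.exp (-((p - μ k) ^ 2 / 4 * n)), fun T hT => ?_⟩
  have hind : ∀ A : Set Ω, MeasurableSet A →
      Integrable (fun ω => A.indicator (fun _ => (1 : ℝ)) ω) P := fun A hA =>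
    (integrable_const 1).indicator hA
  have hint : ∀ A : Set Ω, MeasurableSet A → ∫ ω, A.indicator (fun _ => (1 : ℝ)) ω ∂P = P.real A :=
    fun A hA => by rw [integral_indicator_const _ hA]; simp
  have mN := fun j t => measurableSet_largeNoise henv j δ t
  have mL := fun t => measurableSet_lowIndex (c := c) henv hπ i (q + 2 * δ) t
  have mH := fun n => measurableSet_highMean henv hπ k p T n
  have hI3 : ∀ t, Integrable (fun ω => (largeNoise Z k δ t).indicator (fun _ => (1 : ℝ)) ω
      + (largeNoise Z i δ t).indicator (fun _ => (1 : ℝ)) ω) P := fun t =>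
    (hind _ (mN k t)).add (hind _ (mN i t))
  have hI4 : ∀ t, Integrable (fun ω => (largeNoise Z k δ t).indicator (fun _ => (1 : ℝ)) ω
      + (largeNoise Z i δ t).indicator (fun _ => (1 : ℝ)) ω
      + (lowIndex c X π i (q + 2 * δ) t).indicator (fun _ => (1 : ℝ)) ω) P := fun t =>
    (hI3 t).add (hind _ (mL t))
  have hI1 : Integrable (fun ω => ∑ t ∈ Finset.Ico 3 T,
      ((largeNoise Z k δ t).indicator (fun _ => (1 : ℝ)) ω
        + (largeNoise Z i δ t).indicator (fun _ => (1 : ℝ)) ω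
        + (lowIndex c X π i (q + 2 * δ) t).indicator (fun _ => (1 : ℝ)) ω)) P :=
    integrable_finsetSum _ fun t _ => hI4 t
  have hI2 : Integrable (fun ω => ∑ n ∈ Finset.range T,
      (highMean X π k p T n).indicator (fun _ => (1 : ℝ)) ω) P :=
    integrable_finsetSum _ fun n _ => hind _ (mH n)
  have hae : ∀ᵐ ω ∂P, (pulls π k T ω : ℝ) ≤ 3 + explore c T / klReal p q
      + ∑ t ∈ Finset.Ico 3 T, ((largeNoise Z k δ t).indicator (fun _ => (1 : ℝ)) ω
        + (largeNoise Z i δ t).indicator (fun _ => (1 : ℝ)) ω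
        + (lowIndex c X π i (q + 2 * δ) t).indicator (fun _ => (1 : ℝ)) ω)
      + ∑ n ∈ Finset.range T, (highMean X π k p T n).indicator (fun _ => (1 : ℝ)) ω := by
    have h1 : ∀ j, ∀ᵐ ω ∂P, ∀ s, 1 ≤ s → X j s ω = 1 ∨ X j s ω = 0 := fun j =>
      ae_all_iff.2 fun s => by
        by_cases hs : 1 ≤ s
        · filter_upwards [henv.ae_eq_one_or_zero j hs] with ω hω _ using hω
        · exact ae_of_all _ fun ω h => absurd h hs
    have h2 : ∀ᵐ ω ∂P, ∀ t, 3 ≤ t →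
        perturbedIndex c X Z π i t ω ≤ perturbedIndex c X Z π (π t ω) t ω :=
      ae_all_iff.2 fun s => by
        by_cases hs : 3 ≤ s
        · filter_upwards [hrun.argmax s hs] with ω hω _ using hω i
        · exact ae_of_all _ fun ω h => absurd h hs
    filter_upwards [h1 k, h1 i, h2] with ω hk hi hmax
    exact pulls_le_sum_indicator hc k i hk hi hmax (by linarith) hpq hδ0 (by linarith) hT
  have hI0 : Integrable (fun ω => 3 + explore c T / klReal p q + ∑ t ∈ Finset.Ico 3 T,
      ((largeNoise Z k δ t).indicator (fun _ => (1 : ℝ)) ω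
        + (largeNoise Z i δ t).indicator (fun _ => (1 : ℝ)) ω
        + (lowIndex c X π i (q + 2 * δ) t).indicator (fun _ => (1 : ℝ)) ω)) P :=
    (integrable_const _).add hI1
  have hle := integral_mono_ae (integrable_pulls henv hπ k T) (hI0.add hI2) hae
  simp only [Pi.add_apply] at hle
  rw [integral_add hI0 hI2, integral_add (integrable_const _) hI1,
    integral_finsetSum _ (fun n _ => hind _ (mH n)),
    integral_finsetSum _ (fun t _ => hI4 t)] at hle
  have hsplit : ∀ t, ∫ ω, ((largeNoise Z k δ t).indicator (fun _ => (1 : ℝ)) ω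
        + (largeNoise Z i δ t).indicator (fun _ => (1 : ℝ)) ω
        + (lowIndex c X π i (q + 2 * δ) t).indicator (fun _ => (1 : ℝ)) ω) ∂P
      = P.real (largeNoise Z k δ t) + P.real (largeNoise Z i δ t)
        + P.real (lowIndex c X π i (q + 2 * δ) t) := by
    intro t
    rw [integral_add (hI3 t) (hind _ (mL t)),
      integral_add (hind _ (mN k t)) (hind _ (mN i t)), hint _ (mN k t), hint _ (mN i t),
      hint _ (mL t)]
  simp only [hsplit, fun n => hint _ (mH n), Finset.sum_add_distrib] at hle
  have b1 : ∀ j, ∑ t ∈ Finset.Ico 3 T, P.real (largeNoise Z j δ t)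
      ≤ ∑' t : ℕ, (δ ^ 2)⁻¹ * (1 / (t : ℝ) ^ 2) := fun j =>
    (Finset.sum_le_sum fun t ht => measureReal_largeNoise_le henv j hδ0
      (by have := (Finset.mem_Ico.1 ht).1; omega)).trans
      (hs1.sum_le_tsum _ fun t _ => by positivity)
  have b2 : ∑ t ∈ Finset.Ico 3 T, P.real (lowIndex c X π i (q + 2 * δ) t)
      ≤ ∑' t : ℕ, S * (1 / (t : ℝ) ^ (1 + g)) :=
    (Finset.sum_le_sum fun t ht => measureReal_lowIndex_le henv hπ hc i (by linarith) hr1 hr2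
      (Finset.mem_Ico.1 ht).1).trans (hs2.sum_le_tsum _ fun t _ => by positivity)
  have b3 : ∑ n ∈ Finset.range T, P.real (highMean X π k p T n)
      ≤ ∑' n : ℕ, ((n : ℝ) + 1) * Real.exp (-((p - μ k) ^ 2 / 4 * n)) :=
    (Finset.sum_le_sum fun n _ => measureReal_highMean_le henv hπ k hp (by linarith) T n).trans
      (hs3.sum_le_tsum _ fun n _ => by positivity)
  have b4 := b1 k
  have b5 := b1 i
  have b6 : ∫ _ : Ω, (3 + explore c T / klReal p q) ∂P = 3 + explore c T / klReal p q := by simp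
  rw [b6] at hle
  linarith

end

end RandSelfishKLUCB

/-! ### Optimizing the levels and passing to the limit -/

namespace RandSelfishKLUCB

/-- The inverse of the Bernoulli Kullback-Leibler divergence, for `p < q ≤ 1`. -/
noncomputable def invKL (p q : ℝ) : ℝ :=
  if q = 1 then 0 else 1 / klReal p q

lemma invKL_nonneg {p q : ℝ} (hp0 : 0 ≤ p) (hpq : p < q) (hq1 : q ≤ 1) : 0 ≤ invKL p q := by
  rw [invKL]
  split_ifs with h
  · rfl
  · exact (one_div_pos.2 (klReal_pos hp0 hpq (lt_of_le_of_ne hq1 h))).le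

lemma coe_div_bernoulliKL {p q : ℝ} (hp0 : 0 ≤ p) (hpq : p < q) (hq1 : q ≤ 1) (x : ℝ) :
    (x : EReal) / bernoulliKL p q = ((x * invKL p q : ℝ) : EReal) := by
  rw [invKL]
  split_ifs with h
  · rw [bernoulliKL, if_pos (Or.inr ⟨h, by linarith⟩)]
    simp
  · rw [bernoulliKL_eq_klReal (by linarith) (lt_of_le_of_ne hq1 h), ← EReal.coe_div, mul_one_div]

/-- Continuity in each variable separately suffices: `q` is moved first, then `p` with `q` fixed. -/
lemma exists_lt_klReal_of_lt_one {a b M : ℝ} (ha : 0 ≤ a) (hab : a < b) (hb : b < 1)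
    (hM : M < klReal a b) : ∃ p q, a < p ∧ p < q ∧ q < b ∧ M < klReal p q := by
  have hcq : ContinuousAt (fun q => klReal a q) b := by
    have hb0 : b ≠ 0 := by linarith
    have hb1 : 1 - b ≠ 0 := by linarith
    have h : ContinuousAt (fun q => a * Real.log a + (1 - a) * Real.log (1 - a)
        - a * Real.log q - (1 - a) * Real.log (1 - q)) b := by
      fun_prop (disch := assumption)
    refine h.congr ?_
    filter_upwards [Ioo_mem_nhds (by linarith : 0 < b) hb] with q hq
    exact (klReal_eq hq.1 hq.2).symm
  obtain ⟨q, hq1, hq2, hq3⟩ := (((hcq.eventually (lt_mem_nhds hM)).filter_mono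
    nhdsWithin_le_nhds).and (Ioo_mem_nhdsLT hab)).exists
  have hcp : Continuous (fun p => klReal p q) := by
    have : (fun p => klReal p q) = fun p => p * Real.log p + (1 - p) * Real.log (1 - p)
        - p * Real.log q - (1 - p) * Real.log (1 - q) := by
      funext p
      exact klReal_eq (by linarith) (by linarith)
    rw [this]
    have h1 := Real.continuous_mul_log
    have h2 := h1.comp (continuous_const.sub continuous_id : Continuous fun p : ℝ => 1 - p)
    exact ((h1.add h2).sub (continuous_id.mul continuous_const)).sub
      ((continuous_const.sub continuous_id).mul continuous_const)
  obtain ⟨p, hp1, hp2, hp3⟩ := (((hcp.continuousAt.eventually (lt_mem_nhds hq1)).filter_mono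
    nhdsWithin_le_nhds).and (Ioo_mem_nhdsGT hq2)).exists
  exact ⟨p, q, hp2, hp3, hq3, hp1⟩

lemma exists_lt_klReal {a b ε : ℝ} (ha : 0 ≤ a) (hab : a < b) (hb : b ≤ 1) (hε : 0 < ε) :
    ∃ p q, a < p ∧ p < q ∧ q < b ∧ 1 / klReal p q < invKL a b + ε := by
  have hinv := invKL_nonneg ha hab hb
  have key : ∃ p q, a < p ∧ p < q ∧ q < b ∧ 1 / (invKL a b + ε) < klReal p q := by
    rcases hb.eq_or_lt with rfl | hb
    · obtain ⟨M, hM⟩ : ∃ M, M = 1 / (invKL a 1 + ε) := ⟨_, rfl⟩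
      obtain ⟨C, hC⟩ : ∃ C, C = a * Real.log a + (1 - a) * Real.log (1 - a) := ⟨_, rfl⟩
      have ha1 : 0 < 1 - a := by linarith
      -- Since `klReal a (1 - x) ≥ C - (1 - a) log x`, the exponential makes it at least `M + 1`;
      -- the other bound keeps `1 - x > a`.
      obtain ⟨x, hx⟩ : ∃ x, x = min ((1 - a) / 2) (Real.exp (-((M + 1 - C) / (1 - a)))) :=
        ⟨_, rfl⟩
      have hx0 : 0 < x := by rw [hx]; exact lt_min (by linarith) (Real.exp_pos _)
      have hx1 : x ≤ (1 - a) / 2 := by rw [hx]; exact min_le_left _ _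
      have hx2 : x ≤ Real.exp (-((M + 1 - C) / (1 - a))) := by rw [hx]; exact min_le_right _ _
      have hlog : Real.log x ≤ -((M + 1 - C) / (1 - a)) := (Real.log_le_iff_le_exp hx0).2 hx2
      have hkl : M < klReal a (1 - x) := by
        rw [klReal_eq (by linarith) (by linarith), ← hC, sub_sub_cancel]
        have e1 : Real.log (1 - x) ≤ 0 := Real.log_nonpos (by linarith) (by linarith)
        have e2 := mul_le_mul_of_nonneg_left hlog ha1.le
        have e3 : (1 - a) * -((M + 1 - C) / (1 - a)) = -(M + 1 - C) := by field_simp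
        have e4 := mul_nonpos_of_nonneg_of_nonpos ha e1
        linarith
      obtain ⟨p, q, h1, h2, h3, h4⟩ := exists_lt_klReal_of_lt_one ha
        (by linarith : a < 1 - x) (by linarith) hkl
      exact ⟨p, q, h1, h2, by linarith, hM ▸ h4⟩
    · refine exists_lt_klReal_of_lt_one ha hab hb ?_
      have hpos := klReal_pos ha hab hb
      rw [invKL, if_neg hb.ne, one_div_lt (by positivity) hpos]
      linarith
  obtain ⟨p, q, h1, h2, h3, h4⟩ := key
  refine ⟨p, q, h1, h2, h3, ?_⟩
  rwa [one_div_lt (klReal_pos (by linarith) h2 (by linarith)) (by linarith)]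

lemma eventually_mul_explore_add_le (c C : ℝ) {a ε : ℝ} (hε : 0 < ε) :
    ∀ᶠ T : ℕ in atTop, a * explore c T + C ≤ (a + ε) * Real.log T := by
  have hlog : Tendsto (fun T : ℕ => Real.log T) atTop atTop :=
    Real.tendsto_log_atTop.comp tendsto_natCast_atTop_atTop
  have h1 : (fun T : ℕ => Real.log (Real.log T)) =o[atTop] fun T : ℕ => Real.log T :=
    Real.isLittleO_log_id_atTop.comp_tendsto hlog
  have h2 : (fun _ : ℕ => C) =o[atTop] fun T : ℕ => Real.log T :=
    Asymptotics.isLittleO_const_left.2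
      (Or.inr (tendsto_abs_atTop_atTop.comp hlog))
  have h3 := ((h1.const_mul_left (a * c)).add h2).def hε
  filter_upwards [h3, hlog.eventually_ge_atTop 0] with T hT h0
  rw [Real.norm_of_nonneg h0] at hT
  have := (Real.le_norm_self _).trans hT
  rw [explore]
  linarith

lemma coe_ereal_sum {ι : Type*} (s : Finset ι) (f : ι → ℝ) :
    ((∑ i ∈ s, f i : ℝ) : EReal) = ∑ i ∈ s, (f i : EReal) := by
  classical
  induction s using Finset.induction_on with
  | empty => simp
  | insert a s ha ih => rw [Finset.sum_insert ha, Finset.sum_insert ha, EReal.coe_add, ih]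

lemma limsup_coe_le_of_forall_eventually_le {u : ℕ → ℝ} {C : ℝ}
    (h : ∀ ε > 0, ∀ᶠ T in atTop, u T ≤ C + ε) :
    limsup (fun T => (u T : EReal)) atTop ≤ (C : EReal) := by
  refine EReal.le_of_forall_lt_iff_le.1 fun z hz => limsup_le_of_le (by isBoundedDefault) ?_
  have hz' : C < z := by exact_mod_cast hz
  filter_upwards [h (z - C) (by linarith)] with T hT
  exact_mod_cast (by linarith : u T ≤ z)

section

variable {Ω : Type*} {K : ℕ} {mΩ : MeasurableSpace Ω} {P : Measure Ω}
  {μ : Fin K → unitInterval} {c : ℝ} {X Z : Fin K → ℕ → Ω → ℝ} {π : ℕ → Ω → Fin K}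

/-- Stated at `T + 1` because the regret over rounds `1, …, T` involves `N_k(T + 1)`; the additional
round costs at most 1. -/
lemma eventually_integral_pulls_le [IsProbabilityMeasure P] (henv : IsEnvironment P μ X Z)
    (hrun : IsRun P c X Z π) (hc : 0 ≤ c) (k i : Fin K) (hki : (μ k : ℝ) < μ i) {ε : ℝ}
    (hε : 0 < ε) :
    ∀ᶠ T : ℕ in atTop, ∫ ω, (pulls π k (T + 1) ω : ℝ) ∂P
      ≤ (invKL (μ k) (μ i) + ε) * Real.log T := by
  obtain ⟨p, q, hp, hpq, hq, hkl⟩ :=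
    exists_lt_klReal (μ k).2.1 hki (μ i).2.2 (half_pos hε)
  obtain ⟨C, hC⟩ := exists_integral_pulls_le henv hrun hc k i hp hpq hq
  filter_upwards [eventually_mul_explore_add_le c (C + 1) (a := invKL (μ k) (μ i) + ε / 2)
    (half_pos hε), eventually_ge_atTop 3] with T hT hT3
  have h1 : ∫ ω, (pulls π k (T + 1) ω : ℝ) ∂P ≤ ∫ ω, ((pulls π k T ω : ℝ) + 1) ∂P := by
    refine integral_mono (integrable_pulls henv hrun.adapted k (T + 1))
      ((integrable_pulls henv hrun.adapted k T).add (integrable_const 1)) fun ω => ?_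
    have := pulls_succ (π := π) k (by omega : 1 ≤ T) ω
    have h2 : pulls π k (T + 1) ω ≤ pulls π k T ω + 1 := by
      rw [this]
      split_ifs <;> omega
    have h3 : (pulls π k (T + 1) ω : ℝ) ≤ ((pulls π k T ω + 1 : ℕ) : ℝ) := Nat.cast_le.2 h2
    rwa [Nat.cast_succ] at h3
  rw [integral_add (integrable_pulls henv hrun.adapted k T) (integrable_const 1),
    integral_const] at h1
  simp only [probReal_univ, smul_eq_mul, mul_one] at h1
  have h2 := hC T hT3
  have h3 : explore c T / klReal p q ≤ (invKL (μ k) (μ i) + ε / 2) * explore c T := by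
    rw [div_eq_mul_one_div, mul_comm]
    exact mul_le_mul_of_nonneg_right hkl.le (explore_nonneg hc hT3)
  linarith

/-! ### Regret as a weighted sum of expected pulls -/

/-- The choice of arm is a function of the history, hence independent of the reward of that round.
-/
lemma measureReal_inter_eq_one [IsProbabilityMeasure P] (henv : IsEnvironment P μ X Z)
    (hπ : ∀ t, 1 ≤ t → Measurable[history X Z t] (π t)) (k : Fin K) {t : ℕ} (ht : 1 ≤ t) :
    P.real ({ω | π t ω = k} ∩ {ω | X k t ω = 1}) = P.real {ω | π t ω = k} * μ k := by
  have h1 := (Indep_iff _ _ _).1 (henv.indep_history k t) {ω | π t ω = k} {ω | X k t ω = 1}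
    (hπ t ht (measurableSet_singleton k)) ⟨{1}, measurableSet_singleton 1, rfl⟩
  have h2 : P.real {ω | X k t ω = 1} = μ k := by
    rw [(henv.law_X k t ht).measureReal_eq (p := fun x => x = 1) (measurableSet_singleton 1)]
    classical
    rw [Set.ofPred_eq_eq_singleton, bernoulliMeasure_real_apply _ (measurableSet_singleton (1 : ℝ))]
    simp
  rw [measureReal_def, h1, ENNReal.toReal_mul, ← measureReal_def, ← measureReal_def, h2]

lemma measurableSet_pull (henv : IsEnvironment P μ X Z)
    (hπ : ∀ t, 1 ≤ t → Measurable[history X Z t] (π t)) (k : Fin K) {t : ℕ} (ht : 1 ≤ t) :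
    MeasurableSet {ω | π t ω = k} :=
  henv.history_le t _ (hπ t ht (measurableSet_singleton k))

lemma integral_reward [IsProbabilityMeasure P] (henv : IsEnvironment P μ X Z)
    (hπ : ∀ t, 1 ≤ t → Measurable[history X Z t] (π t)) {t : ℕ} (ht : 1 ≤ t) :
    ∫ ω, reward X π t ω ∂P = ∑ k, P.real {ω | π t ω = k} * μ k := by
  have hm : ∀ k, MeasurableSet ({ω | π t ω = k} ∩ {ω | X k t ω = 1}) := fun k =>
    (measurableSet_pull henv hπ k ht).inter (henv.measurable_X k t (measurableSet_singleton 1))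
  have hae : reward X π t =ᵐ[P] fun ω => ∑ k,
      ({ω | π t ω = k} ∩ {ω | X k t ω = 1}).indicator (fun _ => (1 : ℝ)) ω := by
    filter_upwards [ae_all_iff.2 fun k => henv.ae_eq_one_or_zero k ht] with ω hω
    rw [Finset.sum_eq_single (π t ω)]
    · rcases hω (π t ω) with h | h <;> simp [reward, h]
    · intro k _ hk
      simp [Ne.symm hk]
    · simp
  rw [integral_congr_ae hae, integral_finsetSum _ fun k _ =>
    (integrable_const (1 : ℝ)).indicator (hm k)]
  refine Finset.sum_congr rfl fun k _ => ?_
  rw [integral_indicator_const _ (hm k), smul_eq_mul, mul_one,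
    measureReal_inter_eq_one henv hπ k ht]

lemma sum_measureReal_pull [IsProbabilityMeasure P] (henv : IsEnvironment P μ X Z)
    (hπ : ∀ t, 1 ≤ t → Measurable[history X Z t] (π t)) {t : ℕ} (ht : 1 ≤ t) :
    ∑ k, P.real {ω | π t ω = k} = 1 := by
  have h := sum_measureReal_preimage_singleton (μ := P) (f := π t) Finset.univ
    fun k _ => measurableSet_pull henv hπ k ht
  rw [Finset.coe_univ, Set.preimage_univ, probReal_univ] at h
  exact h

lemma integral_pulls_eq_sum [IsProbabilityMeasure P] (henv : IsEnvironment P μ X Z)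
    (hπ : ∀ t, 1 ≤ t → Measurable[history X Z t] (π t)) (k : Fin K) (T : ℕ) :
    ∫ ω, (pulls π k (T + 1) ω : ℝ) ∂P = ∑ t ∈ Finset.Icc 1 T, P.real {ω | π t ω = k} := by
  have hsum : ∀ ω, (pulls π k (T + 1) ω : ℝ)
      = ∑ t ∈ Finset.Icc 1 T, {ω | π t ω = k}.indicator (fun _ => (1 : ℝ)) ω := fun ω => by
    rw [pulls, Finset.card_filter]
    push_cast
    refine Finset.sum_congr ?_ fun t _ => by simp [Set.indicator_apply]
    ext t
    simp
  simp_rw [hsum]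
  have hm : ∀ t ∈ Finset.Icc 1 T, MeasurableSet {ω | π t ω = k} := fun t ht =>
    measurableSet_pull henv hπ k (Finset.mem_Icc.1 ht).1
  rw [integral_finsetSum _ fun t ht => (integrable_const (1 : ℝ)).indicator (hm t ht)]
  refine Finset.sum_congr rfl fun t ht => ?_
  rw [integral_indicator_const _ (hm t ht), smul_eq_mul, mul_one]

lemma regret_eq_sum [IsProbabilityMeasure P] (henv : IsEnvironment P μ X Z)
    (hπ : ∀ t, 1 ≤ t → Measurable[history X Z t] (π t)) (T : ℕ) :
    regret P μ X π T = ∑ k, (bestMean μ - μ k) * ∫ ω, (pulls π k (T + 1) ω : ℝ) ∂P := by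
  simp_rw [integral_pulls_eq_sum henv hπ, Finset.mul_sum]
  rw [Finset.sum_comm, regret]
  refine Finset.sum_congr rfl fun t ht => ?_
  have h1 := (Finset.mem_Icc.1 ht).1
  rw [integral_reward henv hπ h1]
  simp_rw [sub_mul]
  rw [Finset.sum_sub_distrib, ← Finset.mul_sum, sum_measureReal_pull henv hπ h1, mul_one]
  simp_rw [mul_comm]

/-- Optimal arms have zero gap, so their pulls, which are not controlled here, drop out. -/
lemma regret_eq_sum_filter [IsProbabilityMeasure P] (henv : IsEnvironment P μ X Z)
    (hπ : ∀ t, 1 ≤ t → Measurable[history X Z t] (π t)) (T : ℕ) :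
    regret P μ X π T = ∑ k with (μ k : ℝ) < bestMean μ,
      (bestMean μ - μ k) * ∫ ω, (pulls π k (T + 1) ω : ℝ) ∂P := by
  rw [regret_eq_sum henv hπ]
  refine (Finset.sum_filter_of_ne fun k _ hk => ?_).symm
  refine lt_of_le_of_ne (le_ciSup (Set.finite_range fun j => (μ j : ℝ)).bddAbove k) ?_
  intro h
  rw [h, sub_self, zero_mul] at hk
  exact hk rfl

end

end RandSelfishKLUCB

open RandSelfishKLUCB in
theorem proposition2 {Ω : Type*} [MeasurableSpace Ω] (P : Measure Ω) [IsProbabilityMeasure P]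
    {K : ℕ} (μ : Fin K → unitInterval) (c : ℝ) (hc : 0 ≤ c)
    (X Z : Fin K → ℕ → Ω → ℝ) (π : ℕ → Ω → Fin K)
    (henv : IsEnvironment P μ X Z) (hrun : IsRun P c X Z π) :
    (∀ k, (μ k : ℝ) < bestMean μ →
      limsup (fun T : ℕ => (((∫ ω, (pulls π k T ω : ℝ) ∂P) / Real.log T : ℝ) : EReal)) atTop
        ≤ 1 / bernoulliKL (μ k) (bestMean μ)) ∧
    limsup (fun T : ℕ => ((regret P μ X π T / Real.log T : ℝ) : EReal)) atTop
      ≤ ∑ k with (μ k : ℝ) < bestMean μ,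
          ((bestMean μ - μ k : ℝ) : EReal) / bernoulliKL (μ k) (bestMean μ) := by
  obtain ⟨ω₀⟩ : Nonempty Ω := nonempty_of_isProbabilityMeasure P
  -- A run picks some arm, so `K > 0` and the supremum of the means is attained.
  have : Nonempty (Fin K) := ⟨π 0 ω₀⟩
  obtain ⟨i, hi⟩ : ∃ i, (μ i : ℝ) = bestMean μ := exists_eq_ciSup_of_finite
  have hb1 : bestMean μ ≤ 1 := hi ▸ (μ i).2.2
  have hlog : ∀ᶠ T : ℕ in atTop, 0 < Real.log T :=
    (Real.tendsto_log_atTop.comp tendsto_natCast_atTop_atTop).eventually_gt_atTop 0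
  have hpulls : ∀ k, (μ k : ℝ) < bestMean μ → ∀ ε > 0, ∀ᶠ T : ℕ in atTop,
      ∫ ω, (pulls π k (T + 1) ω : ℝ) ∂P ≤ (invKL (μ k) (bestMean μ) + ε) * Real.log T :=
    fun k hk ε hε => by
      rw [← hi] at hk ⊢
      exact eventually_integral_pulls_le henv hrun hc k i hk hε
  constructor
  · intro k hk
    have hrhs := coe_div_bernoulliKL (μ k).2.1 hk hb1 1
    rw [EReal.coe_one, one_mul] at hrhs
    rw [hrhs]
    refine limsup_coe_le_of_forall_eventually_le fun ε hε => ?_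
    filter_upwards [hpulls k hk ε hε, hlog] with T hT h0
    rw [div_le_iff₀ h0]
    refine le_trans (integral_mono (integrable_pulls henv hrun.adapted k T)
      (integrable_pulls henv hrun.adapted k (T + 1)) fun ω => ?_) hT
    exact Nat.cast_le.2 (pulls_mono k ω (Nat.le_succ T))
  · have hrhs : ∑ k with (μ k : ℝ) < bestMean μ,
        ((bestMean μ - μ k : ℝ) : EReal) / bernoulliKL (μ k) (bestMean μ)
        = ((∑ k with (μ k : ℝ) < bestMean μ,
          (bestMean μ - μ k) * invKL (μ k) (bestMean μ) : ℝ) : EReal) := by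
      rw [coe_ereal_sum]
      refine Finset.sum_congr rfl fun k hk => ?_
      exact coe_div_bernoulliKL (μ k).2.1 (Finset.mem_filter.1 hk).2 hb1 _
    rw [hrhs]
    refine limsup_coe_le_of_forall_eventually_le fun ε hε => ?_
    -- The error is shared among the arms as `ε / (G + 1)`; the added 1 allows for `G = 0`.
    set G := ∑ k with (μ k : ℝ) < bestMean μ, (bestMean μ - μ k) with hG
    have hG0 : 0 ≤ G := Finset.sum_nonneg fun k hk =>
      sub_nonneg.2 (Finset.mem_filter.1 hk).2.le
    have hev : ∀ᶠ T : ℕ in atTop, ∀ k, (μ k : ℝ) < bestMean μ →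
        ∫ ω, (pulls π k (T + 1) ω : ℝ) ∂P
          ≤ (invKL (μ k) (bestMean μ) + ε / (G + 1)) * Real.log T :=
      eventually_all.2 fun k => eventually_imp_distrib_left.2 fun hk =>
        hpulls k hk _ (div_pos hε (by linarith))
    filter_upwards [hev, hlog] with T hT h0
    rw [div_le_iff₀ h0, regret_eq_sum_filter henv hrun.adapted]
    calc _ ≤ ∑ k with (μ k : ℝ) < bestMean μ, (bestMean μ - μ k) *
          ((invKL (μ k) (bestMean μ) + ε / (G + 1)) * Real.log T) :=
          Finset.sum_le_sum fun k hk => mul_le_mul_of_nonneg_left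
            (hT k (Finset.mem_filter.1 hk).2) (sub_nonneg.2 (Finset.mem_filter.1 hk).2.le)
      _ = (∑ k with (μ k : ℝ) < bestMean μ, (bestMean μ - μ k) * invKL (μ k) (bestMean μ)
          + G * (ε / (G + 1))) * Real.log T := by
          rw [hG, Finset.sum_mul, ← Finset.sum_add_distrib, Finset.sum_mul]
          exact Finset.sum_congr rfl fun k _ => by ring
      _ ≤ _ := by
          refine mul_le_mul_of_nonneg_right ?_ h0.le
          have : G * (ε / (G + 1)) ≤ ε := by
            rw [mul_div_assoc', div_le_iff₀ (by linarith)]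
            nlinarith
          linarith
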